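/- Let $\lambda P2^{+}$ be second order dependent type theory $\lambda P2$ extended with identity types, $\Sigma$-types and uniqueness of identity proofs (and without function extensionality), presented as follows. Pseudo-terms are generated by $\star$, $\mathsf{Kind}$, variables, $\Pi x{:}U.T$, $\lambda x{:}U.b$, $f\,a$, $a=^{\sigma}b$, $\mathsf{refl}$, $\mathsf J(c,a,b,q)$, $\Sigma x{:}\sigma.\tau$, $\langle a,b\rangle$, $\pi_1\,p$, $\pi_2\,p$ and a constant $\mathsf{uip}$. Conversion $\simeq$ is the least equivalence relation containing the compatible closure of $$(\lambda x{:}U.b)\,a\to b[x:=a],\quad \mathsf J(c,a,a,\mathsf{refl})\to c\,a,\quad \pi_1\langle a,b\rangle\to a,\quad \pi_2\langle a,b\rangle\to b .$$ The derivable judgments $\Gamma\vdash M:T$ are given inductively by the following rules ($s,s_1,s_2\in\{\star,\mathsf{Kind}\}$; newly declared variables are fresh): * $\vdash\star:\mathsf{Kind}$; if $\Gamma\vdash T:s$ then $\Gamma,v{:}T\vdash v:T$; if $\Gamma\vdash M:U$ and $\Gamma\vdash T:s$ then $\Gamma,v{:}T\vdash M:U$; if $\Gamma\vdash M:T$, $\Gamma\vdash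 U:s$ and $T\simeq U$ then $\Gamma\vdash M:U$. * If $\Gamma\vdash U:s_1$ and $\Gamma,x{:}U\vdash T:s_2$ with $(s_1,s_2)\ne(\mathsf{Kind},\mathsf{Kind})$ then $\Gamma\vdash\Pi x{:}U.T:s_2$; if $\Gamma\vdash\Pi x{:}U.T:s$ and $\Gamma,x{:}U\vdash b:T$ then $\Gamma\vdash\lambda x{:}U.b:\Pi x{:}U.T$; if $\Gamma\vdash f:\Pi x{:}U.T$ and $\Gamma\vdash a:U$ then $\Gamma\vdash f\,a:T[x:=a]$. * If $\Gamma\vdash\sigma:\star$, $\Gamma\vdash a:\sigma$ and $\Gamma\vdash b:\sigma$ then $\Gamma\vdash a=^{\sigma}b:\star$; if $\Gamma\vdash\sigma:\star$ and $\Gamma\vdash a:\sigma$ then $\Gamma\vdash\mathsf{refl}:a=^{\sigma}a$; if $\Gamma\vdash a:\sigma$, $\Gamma\vdash b:\sigma$, $\Gamma\vdash q:a=^{\sigma}b$, $\Gamma,x{:}\sigma,y{:}\sigma,p{:}x=^{\sigma}y\vdash\tau:\star$ and $\Gamma\vdash c:\Pi z{:}\sigma.\,\tau[x,y:=z,\,p:=\mathsf{refl}]$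 then $\Gamma\vdash\mathsf J(c,a,b,q):\tau[x:=a,y:=b,p:=q]$. * If $\Gamma\vdash\sigma:\star$ and $\Gamma,x{:}\sigma\vdash\tau:\star$ then $\Gamma\vdash\Sigma x{:}\sigma.\tau:\star$; if $\Gamma\vdash\Sigma x{:}\sigma.\tau:\star$, $\Gamma\vdash a:\sigma$ and $\Gamma\vdash b:\tau[x:=a]$ then $\Gamma\vdash\langle a,b\rangle:\Sigma x{:}\sigma.\tau$; if $\Gamma\vdash p:\Sigma x{:}\sigma.\tau$ then $\Gamma\vdash\pi_1\,p:\sigma$ and $\Gamma\vdash\pi_2\,p:\tau[x:=\pi_1\,p]$. * $\vdash\mathsf{uip}:\Pi\alpha{:}\star.\,\Pi x,y{:}\alpha.\,\Pi p,q{:}x=^{\alpha}y.\ p=^{x=^{\alpha}y}q$. A type is *derivable* if some $M$ has that type in the empty context. Let $N,0,S$ be closed with $\vdash N:\star$, $\vdash 0:N$ and $\vdash S:N\to N$, and put $$\mathsf{ind}_{N,0,S}:=\Pi P{:}N\to\star.\ P\,0\to(\Pi y{:}N.\ P\,y\to P\,(S\,y))\to\Pi x{:}N.\ P\,x .$$ **Theorem.**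 In $\lambda P2^{+}$ there is no data type of natural numbers with a provable induction principle. Precisely: 1. If $N,0,S$ admits iteration, i.e. there is a closed term $\mathsf{It}:\Pi\alpha{:}\star.\ \alpha\to(\alpha\to\alpha)\to N\to\alpha$ for which the types $\Pi\alpha{:}\star.\Pi x{:}\alpha.\Pi f{:}\alpha\to\alpha.\ \mathsf{It}\,\alpha\,x\,f\,0=^{\alpha}x$ and $\Pi\alpha{:}\star.\Pi x{:}\alpha.\Pi f{:}\alpha\to\alpha.\Pi n{:}N.\ \mathsf{It}\,\alpha\,x\,f\,(S\,n)=^{\alpha}f\,(\mathsf{It}\,\alpha\,x\,f\,n)$ are derivable, then $\mathsf{ind}_{N,0,S}$ is not derivable. 2. More generally, for arbitrary $N,0,S$ as above: if $0=^{N}S\,0$ is not derivable, then $\mathsf{ind}_{N,0,S}$ is not derivable. -/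

import Mathlib

namespace LP2

/-- The two sorts of the system. -/
inductive Srt : Type
  | star : Srt
  | kind : Srt

/-- Pseudo-terms of second order dependent type theory with identity types, sum types and a
constant for uniqueness of identity proofs. Variables are de Bruijn indices; the second argument
of `pi`, `lam` and `sig` is under one binder. -/
inductive Tm : Type
  | srt : Srt → Tm
  | var : ℕ → Tm
  | pi : Tm → Tm → Tm
  | lam : Tm → Tm → Tm
  | app : Tm → Tm → Tm
  /-- `idt σ a b` is the identity type of `a` and `b` over `σ`. -/
  | idt : Tm → Tm → Tm → Tm
  | refl : Tm
  | J : Tm → Tm → Tm → Tm → Tm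
  | sig : Tm → Tm → Tm
  | pair : Tm → Tm → Tm
  | fst : Tm → Tm
  | snd : Tm → Tm
  | uip : Tm

namespace Tm

/-- The sort of types. -/
abbrev star : Tm := srt Srt.star

/-- Extension of a renaming under a binder. -/
def liftRen (r : ℕ → ℕ) : ℕ → ℕ
  | 0 => 0
  | n + 1 => r n + 1

def rename : (ℕ → ℕ) → Tm → Tm
  | _, srt s => srt s
  | r, var n => var (r n)
  | r, pi U T => pi (rename r U) (rename (liftRen r) T)
  | r, lam U b => lam (rename r U) (rename (liftRen r) b)
  | r, app f a => app (rename r f) (rename r a)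
  | r, idt σ a b => idt (rename r σ) (rename r a) (rename r b)
  | _, refl => refl
  | r, J c a b q => J (rename r c) (rename r a) (rename r b) (rename r q)
  | r, sig σ τ => sig (rename r σ) (rename (liftRen r) τ)
  | r, pair a b => pair (rename r a) (rename r b)
  | r, fst p => fst (rename r p)
  | r, snd p => snd (rename r p)
  | _, uip => uip

/-- `shift k M` is `M` regarded in a context with `k` further declarations. -/
def shift (k : ℕ) (M : Tm) : Tm := rename (fun n => n + k) M

/-- Extension of a simultaneous substitution under a binder. -/
def liftSub (f : ℕ → Tm) : ℕ → Tm
  | 0 => var 0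
  | n + 1 => shift 1 (f n)

/-- Simultaneous capture-avoiding substitution. -/
def subst : (ℕ → Tm) → Tm → Tm
  | _, srt s => srt s
  | f, var n => f n
  | f, pi U T => pi (subst f U) (subst (liftSub f) T)
  | f, lam U b => lam (subst f U) (subst (liftSub f) b)
  | f, app g a => app (subst f g) (subst f a)
  | f, idt σ a b => idt (subst f σ) (subst f a) (subst f b)
  | _, refl => refl
  | f, J c a b q => J (subst f c) (subst f a) (subst f b) (subst f q)
  | f, sig σ τ => sig (subst f σ) (subst (liftSub f) τ)
  | f, pair a b => pair (subst f a) (subst f b)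
  | f, fst p => fst (subst f p)
  | f, snd p => snd (subst f p)
  | _, uip => uip

/-- The substitution that sends index `0` to `a` and index `n + 1` to `f n`. -/
def scons (a : Tm) (f : ℕ → Tm) : ℕ → Tm
  | 0 => a
  | n + 1 => f n

/-- `inst a T` is `T[x := a]`, where `x` is the last declared variable. -/
def inst (a T : Tm) : Tm := subst (scons a var) T

/-- `inst3 a b q T` is `T[x := a, y := b, p := q]`, for `T` in a context `Γ, x, y, p` and
`a`, `b`, `q` in the context `Γ`. -/
def inst3 (a b q T : Tm) : Tm := subst (scons q (scons b (scons a var))) T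

/-- For `T` in a context `Γ, x, y, p`, the term `T[x := z, y := z, p := refl]` in the context
`Γ, z`. -/
def instDiag (T : Tm) : Tm :=
  subst (scons refl (scons (var 0) (scons (var 0) (fun n => var (n + 1))))) T

/-- The non-dependent function type. -/
def arr (U T : Tm) : Tm := pi U (shift 1 T)

/-- `Π α : ⋆. Π x y : α. Π p q : x = y. p = q`. -/
def UIPType : Tm :=
  pi star (pi (var 0) (pi (var 1)
    (pi (idt (var 2) (var 1) (var 0)) (pi (idt (var 3) (var 2) (var 1))
      (idt (idt (var 4) (var 3) (var 2)) (var 1) (var 0))))))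

end Tm

open Tm

/-- One-step reduction: the compatible closure of the rule `β`, the rule for `J`, and the two
rules for projections. -/
inductive Step : Tm → Tm → Prop
  | beta (U b a : Tm) : Step (app (lam U b) a) (inst a b)
  | J_refl (c a : Tm) : Step (J c a a refl) (app c a)
  | fst_pair (a b : Tm) : Step (fst (pair a b)) a
  | snd_pair (a b : Tm) : Step (snd (pair a b)) b
  | pi_left {U U' : Tm} (T : Tm) : Step U U' → Step (pi U T) (pi U' T)
  | pi_right (U : Tm) {T T' : Tm} : Step T T' → Step (pi U T) (pi U T')
  | lam_left {U U' : Tm} (b : Tm) : Step U U' → Step (lam U b) (lam U' b)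
  | lam_right (U : Tm) {b b' : Tm} : Step b b' → Step (lam U b) (lam U b')
  | app_left {f f' : Tm} (a : Tm) : Step f f' → Step (app f a) (app f' a)
  | app_right (f : Tm) {a a' : Tm} : Step a a' → Step (app f a) (app f a')
  | idt_type {σ σ' : Tm} (a b : Tm) : Step σ σ' → Step (idt σ a b) (idt σ' a b)
  | idt_left (σ : Tm) {a a' : Tm} (b : Tm) : Step a a' → Step (idt σ a b) (idt σ a' b)
  | idt_right (σ a : Tm) {b b' : Tm} : Step b b' → Step (idt σ a b) (idt σ a b')
  | J_1 {c c' : Tm} (a b q : Tm) : Step c c' → Step (J c a b q) (J c' a b q)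
  | J_2 (c : Tm) {a a' : Tm} (b q : Tm) : Step a a' → Step (J c a b q) (J c a' b q)
  | J_3 (c a : Tm) {b b' : Tm} (q : Tm) : Step b b' → Step (J c a b q) (J c a b' q)
  | J_4 (c a b : Tm) {q q' : Tm} : Step q q' → Step (J c a b q) (J c a b q')
  | sig_left {σ σ' : Tm} (τ : Tm) : Step σ σ' → Step (sig σ τ) (sig σ' τ)
  | sig_right (σ : Tm) {τ τ' : Tm} : Step τ τ' → Step (sig σ τ) (sig σ τ')
  | pair_left {a a' : Tm} (b : Tm) : Step a a' → Step (pair a b) (pair a' b)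
  | pair_right (a : Tm) {b b' : Tm} : Step b b' → Step (pair a b) (pair a b')
  | fst_congr {p p' : Tm} : Step p p' → Step (fst p) (fst p')
  | snd_congr {p p' : Tm} : Step p p' → Step (snd p) (snd p')

/-- Conversion: the reflexive, symmetric, transitive closure of one-step reduction. -/
def Conv : Tm → Tm → Prop := Relation.EqvGen Step

/-- The judgment `Γ ⊢ M : T`. Contexts are lists with the last declaration first. -/
inductive Typed : List Tm → Tm → Tm → Prop
  | ax : Typed [] (srt Srt.star) (srt Srt.kind)
  | var {Γ : List Tm} {T : Tm} {s : Srt} :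
      Typed Γ T (srt s) → Typed (T :: Γ) (var 0) (shift 1 T)
  | weak {Γ : List Tm} {M U T : Tm} {s : Srt} :
      Typed Γ M U → Typed Γ T (srt s) → Typed (T :: Γ) (shift 1 M) (shift 1 U)
  | conv {Γ : List Tm} {M T U : Tm} {s : Srt} :
      Typed Γ M T → Typed Γ U (srt s) → Conv T U → Typed Γ M U
  | pi {Γ : List Tm} {U T : Tm} {s₁ s₂ : Srt} :
      ¬ (s₁ = Srt.kind ∧ s₂ = Srt.kind) →
      Typed Γ U (srt s₁) → Typed (U :: Γ) T (srt s₂) → Typed Γ (pi U T) (srt s₂)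
  | lam {Γ : List Tm} {U T b : Tm} {s : Srt} :
      Typed Γ (Tm.pi U T) (srt s) → Typed (U :: Γ) b T → Typed Γ (lam U b) (Tm.pi U T)
  | app {Γ : List Tm} {U T f a : Tm} :
      Typed Γ f (Tm.pi U T) → Typed Γ a U → Typed Γ (app f a) (inst a T)
  | idt {Γ : List Tm} {σ a b : Tm} :
      Typed Γ σ star → Typed Γ a σ → Typed Γ b σ → Typed Γ (idt σ a b) star
  | refl {Γ : List Tm} {σ a : Tm} :
      Typed Γ σ star → Typed Γ a σ → Typed Γ refl (Tm.idt σ a a)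
  | J {Γ : List Tm} {σ τ a b c q : Tm} :
      Typed Γ a σ → Typed Γ b σ → Typed Γ q (Tm.idt σ a b) →
      Typed (Tm.idt (shift 2 σ) (Tm.var 1) (Tm.var 0) :: shift 1 σ :: σ :: Γ) τ star →
      Typed Γ c (Tm.pi σ (instDiag τ)) →
      Typed Γ (J c a b q) (inst3 a b q τ)
  | sig {Γ : List Tm} {σ τ : Tm} :
      Typed Γ σ star → Typed (σ :: Γ) τ star → Typed Γ (sig σ τ) star
  | pair {Γ : List Tm} {σ τ a b : Tm} :
      Typed Γ (Tm.sig σ τ) star → Typed Γ a σ → Typed Γ b (inst a τ) →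
      Typed Γ (pair a b) (Tm.sig σ τ)
  | fst {Γ : List Tm} {σ τ p : Tm} :
      Typed Γ p (Tm.sig σ τ) → Typed Γ (fst p) σ
  | snd {Γ : List Tm} {σ τ p : Tm} :
      Typed Γ p (Tm.sig σ τ) → Typed Γ (snd p) (inst (Tm.fst p) τ)
  | uip : Typed [] uip UIPType

/-- A type is derivable when it is inhabited by a term in the empty context. -/
def Derivable (T : Tm) : Prop := ∃ M : Tm, Typed [] M T

/-- A closed type `N` with a closed `Z : N` and a closed `S : N → N`. -/
structure IsNatSignature (N Z S : Tm) : Prop where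
  type : Typed [] N star
  zero : Typed [] Z N
  succ : Typed [] S (arr N N)

/-- `Π P : N → ⋆. P Z → (Π y : N. P y → P (S y)) → Π x : N. P x`. -/
def indType (N Z S : Tm) : Tm :=
  pi (arr N star)
    (arr (app (var 0) (shift 1 Z))
      (arr
        (pi (shift 1 N) (arr (app (var 1) (var 0)) (app (var 1) (app (shift 2 S) (var 0)))))
        (pi (shift 1 N) (app (var 1) (var 0)))))

/-- `Π α : ⋆. α → (α → α) → N → α`. -/
def iterType (N : Tm) : Tm :=
  pi star (arr (var 0) (arr (arr (var 0) (var 0)) (arr (shift 1 N) (var 0))))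

/-- `Π α : ⋆. Π x : α. Π f : α → α. It α x f Z = x`. -/
def iterZeroType (Z It : Tm) : Tm :=
  pi star (pi (var 0) (pi (arr (var 1) (var 1))
    (idt (var 2)
      (app (app (app (app (shift 3 It) (var 2)) (var 1)) (var 0)) (shift 3 Z))
      (var 1))))

/-- `Π α : ⋆. Π x : α. Π f : α → α. Π n : N. It α x f (S n) = f (It α x f n)`. -/
def iterSuccType (N S It : Tm) : Tm :=
  pi star (pi (var 0) (pi (arr (var 1) (var 1)) (pi (shift 3 N)
    (idt (var 3)
      (app (app (app (app (shift 4 It) (var 3)) (var 2)) (var 1)) (app (shift 4 S) (var 0)))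
      (app (var 1) (app (app (app (app (shift 4 It) (var 3)) (var 2)) (var 1)) (var 0)))))))

/-- Functions can be defined on `N` by iteration, with provable computation rules. -/
def HasIteration (N Z S : Tm) : Prop :=
  ∃ It : Tm, Typed [] It (iterType N) ∧
    Derivable (iterZeroType Z It) ∧ Derivable (iterSuccType N S It)

end LP2

/-! The proof uses a realizability model whose realizers are pseudo-terms up to conversion. Erasure
`tr` drops types, encodes pairs as functions and makes identity proofs trivial. A type denotes a set
of realizers that is saturated under conversion and obeys a dichotomy (`PolySet`): either it is
closed under `tag`, an η-expansion marked by the annotation `Kind`, or all its elements are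
convertible to `refl`. Products and sums fall on the first side, since membership in them depends
only on how a term acts on arguments, while conversion has no η-rule that would identify a term with
its tagged copy. Identity types fall on the second side. Type variables range over all such sets,
constructor variables over families of them, and every rule is sound, uniqueness of identity proofs
included (`Typed.sound`).

Suppose that induction is derivable. Being convertible to a numeral is an admissible predicate in
the model, so every realizer of `N` is convertible to a numeral (`exists_conv_num`). Erased terms
carry only the annotation `star`, and reduction preserves this, so by Church–Rosser no numeral is
convertible to a tagged term (`NoTag.not_conv_tag`). Hence `N` is not closed under `tag`
(`not_tag_closed`), and the dichotomy makes all its realizers convertible to `refl`. Zero and one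
then have convertible realizers, which iteration refutes (`not_conv_zero_one`).

The second statement needs a dichotomy that speaks of derivability: a closed type has a `tag`-closed
interpretation, or any two of its closed inhabitants are provably equal (`Typed.tagOrProp`). It
follows from a computability argument on typing derivations (`Typed.red`), in which `uip` settles
identity types; no normalization theorem is needed.

The interpretation is defined on raw terms, and its invariance under conversion is proved for those
recognizable as constructors or kinds. The coarse classification `Cs` isolates them, and
`Typed.hasCls` extracts it from derivations. -/

namespace LP2

/-! ### Calculus of renamings and substitutions. -/

namespace Tm

theorem liftRen_comp (r s : ℕ → ℕ) :
    (fun n => liftRen r (liftRen s n)) = liftRen fun n => r (s n) := by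
  funext n; cases n <;> rfl

theorem rename_rename (M : Tm) (r s : ℕ → ℕ) :
    rename r (rename s M) = rename (fun n => r (s n)) M := by
  induction M generalizing r s <;> simp [rename, liftRen_comp, *]

theorem liftSub_liftRen (f : ℕ → Tm) (r : ℕ → ℕ) :
    (fun n => liftSub f (liftRen r n)) = liftSub fun n => f (r n) := by
  funext n; cases n <;> rfl

theorem subst_rename (M : Tm) (f : ℕ → Tm) (r : ℕ → ℕ) :
    subst f (rename r M) = subst (fun n => f (r n)) M := by
  induction M generalizing f r <;> simp [rename, subst, liftSub_liftRen, *]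

theorem rename_liftSub (f : ℕ → Tm) (r : ℕ → ℕ) :
    (fun n => rename (liftRen r) (liftSub f n)) = liftSub fun n => rename r (f n) := by
  funext n
  cases n with
  | zero => rfl
  | succ n => simp [liftSub, shift, rename_rename, liftRen]

theorem rename_subst (M : Tm) (f : ℕ → Tm) (r : ℕ → ℕ) :
    rename r (subst f M) = subst (fun n => rename r (f n)) M := by
  induction M generalizing f r <;> simp [rename, subst, rename_liftSub, *]

theorem subst_liftSub (f g : ℕ → Tm) :
    (fun n => subst (liftSub g) (liftSub f n)) = liftSub fun n => subst g (f n) := by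
  funext n
  cases n with
  | zero => rfl
  | succ n => simp [liftSub, shift, subst_rename, rename_subst]

theorem subst_subst (M : Tm) (f g : ℕ → Tm) :
    subst g (subst f M) = subst (fun n => subst g (f n)) M := by
  induction M generalizing f g <;> simp [subst, subst_liftSub, *]

theorem liftSub_var : liftSub var = var := by
  funext n; cases n <;> rfl

theorem subst_var (M : Tm) : subst var M = M := by
  induction M <;> simp [subst, liftSub_var, *]

theorem liftSub_var_comp (r : ℕ → ℕ) : liftSub (fun n => var (r n)) = fun n => var (liftRen r n) := by
  funext n; cases n <;> rfl

theorem rename_eq_subst (M : Tm) (r : ℕ → ℕ) : rename r M = subst (fun n => var (r n)) M := by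
  induction M generalizing r <;> simp [rename, subst, liftSub_var_comp, *]

theorem subst_shift (M : Tm) (f : ℕ → Tm) (k : ℕ) :
    subst f (shift k M) = subst (fun n => f (n + k)) M :=
  subst_rename M f _

theorem subst_scons_shift (M a : Tm) (f : ℕ → Tm) : subst (scons a f) (shift 1 M) = subst f M :=
  subst_rename M _ _

theorem subst_scons_liftSub (a : Tm) (f g : ℕ → Tm) :
    (fun n => subst (scons a g) (liftSub f n)) = scons a fun n => subst g (f n) := by
  funext n
  cases n with
  | zero => rfl
  | succ n => exact subst_scons_shift (f n) a g

theorem inst_subst_liftSub (M a : Tm) (f : ℕ → Tm) :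
    inst a (subst (liftSub f) M) = subst (scons a f) M := by
  rw [inst, subst_subst, subst_scons_liftSub]; simp only [subst_var]

theorem subst_inst (M a : Tm) (f : ℕ → Tm) :
    subst f (inst a M) = inst (subst f a) (subst (liftSub f) M) := by
  rw [inst_subst_liftSub, inst, subst_subst]
  congr 1; funext n; cases n <;> rfl

theorem rename_inst (M a : Tm) (r : ℕ → ℕ) :
    rename r (inst a M) = inst (rename r a) (rename (liftRen r) M) := by
  simp only [rename_eq_subst, subst_inst, liftSub_var_comp]

theorem liftRen_eq_succ (M : Tm) (r : ℕ → ℕ) :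
    rename (liftRen r) (shift 1 M) = shift 1 (rename r M) := by
  simp [shift, rename_rename, liftRen]

theorem liftSub_shift (M : Tm) (f : ℕ → Tm) :
    subst (liftSub f) (shift 1 M) = shift 1 (subst f M) := by
  simp [shift, subst_rename, rename_subst, liftSub]

end Tm

open Tm

/-! ### Conversion is a congruence. -/

namespace Conv

theorem rfl' {M : Tm} : Conv M M := Relation.EqvGen.refl M

theorem of_step {M N : Tm} (h : Step M N) : Conv M N := Relation.EqvGen.rel _ _ h

theorem symm' {M N : Tm} (h : Conv M N) : Conv N M := Relation.EqvGen.symm _ _ h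

theorem trans' {M N P : Tm} (h : Conv M N) (h' : Conv N P) : Conv M P :=
  Relation.EqvGen.trans _ _ _ h h'

/-- A map that sends steps to conversions preserves conversion. -/
theorem map {φ : Tm → Tm} (hφ : ∀ M N, Step M N → Conv (φ M) (φ N)) {M N : Tm} (h : Conv M N) :
    Conv (φ M) (φ N) := by
  induction h with
  | rel _ _ h => exact hφ _ _ h
  | refl _ => exact rfl'
  | symm _ _ _ ih => exact ih.symm'
  | trans _ _ _ _ _ ih₁ ih₂ => exact ih₁.trans' ih₂

theorem pi {U U' T T' : Tm} (h : Conv U U') (h' : Conv T T') : Conv (Tm.pi U T) (Tm.pi U' T') :=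
  (map (φ := fun X => Tm.pi X T) (fun _ _ s => of_step (.pi_left _ s)) h).trans'
    (map (φ := fun X => Tm.pi U' X) (fun _ _ s => of_step (.pi_right _ s)) h')

theorem lam {U U' T T' : Tm} (h : Conv U U') (h' : Conv T T') : Conv (Tm.lam U T) (Tm.lam U' T') :=
  (map (φ := fun X => Tm.lam X T) (fun _ _ s => of_step (.lam_left _ s)) h).trans'
    (map (φ := fun X => Tm.lam U' X) (fun _ _ s => of_step (.lam_right _ s)) h')

theorem app {U U' T T' : Tm} (h : Conv U U') (h' : Conv T T') : Conv (Tm.app U T) (Tm.app U' T') :=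
  (map (φ := fun X => Tm.app X T) (fun _ _ s => of_step (.app_left _ s)) h).trans'
    (map (φ := fun X => Tm.app U' X) (fun _ _ s => of_step (.app_right _ s)) h')

theorem sig {U U' T T' : Tm} (h : Conv U U') (h' : Conv T T') : Conv (Tm.sig U T) (Tm.sig U' T') :=
  (map (φ := fun X => Tm.sig X T) (fun _ _ s => of_step (.sig_left _ s)) h).trans'
    (map (φ := fun X => Tm.sig U' X) (fun _ _ s => of_step (.sig_right _ s)) h')

theorem pair {U U' T T' : Tm} (h : Conv U U') (h' : Conv T T') :
    Conv (Tm.pair U T) (Tm.pair U' T') :=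
  (map (φ := fun X => Tm.pair X T) (fun _ _ s => of_step (.pair_left _ s)) h).trans'
    (map (φ := fun X => Tm.pair U' X) (fun _ _ s => of_step (.pair_right _ s)) h')

theorem fst {p p' : Tm} (h : Conv p p') : Conv (Tm.fst p) (Tm.fst p') :=
  map (fun _ _ s => of_step (.fst_congr s)) h

theorem snd {p p' : Tm} (h : Conv p p') : Conv (Tm.snd p) (Tm.snd p') :=
  map (fun _ _ s => of_step (.snd_congr s)) h

theorem idt {σ σ' a a' b b' : Tm} (h₁ : Conv σ σ') (h₂ : Conv a a') (h₃ : Conv b b') :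
    Conv (Tm.idt σ a b) (Tm.idt σ' a' b') :=
  ((map (φ := fun X => Tm.idt X a b) (fun _ _ s => of_step (.idt_type _ _ s)) h₁).trans'
    (map (φ := fun X => Tm.idt σ' X b) (fun _ _ s => of_step (.idt_left _ _ s)) h₂)).trans'
    (map (φ := fun X => Tm.idt σ' a' X) (fun _ _ s => of_step (.idt_right _ _ s)) h₃)

theorem J {c c' a a' b b' q q' : Tm} (h₁ : Conv c c') (h₂ : Conv a a') (h₃ : Conv b b')
    (h₄ : Conv q q') : Conv (Tm.J c a b q) (Tm.J c' a' b' q') :=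
  (((map (φ := fun X => Tm.J X a b q) (fun _ _ s => of_step (.J_1 _ _ _ s)) h₁).trans'
    (map (φ := fun X => Tm.J c' X b q) (fun _ _ s => of_step (.J_2 _ _ _ s)) h₂)).trans'
    (map (φ := fun X => Tm.J c' a' X q) (fun _ _ s => of_step (.J_3 _ _ _ s)) h₃)).trans'
    (map (φ := fun X => Tm.J c' a' b' X) (fun _ _ s => of_step (.J_4 _ _ _ s)) h₄)

end Conv

theorem Step.subst {M N : Tm} (h : Step M N) (f : ℕ → Tm) :
    Step (Tm.subst f M) (Tm.subst f N) := by
  induction h generalizing f with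
  | beta U b a => rw [subst_inst]; exact .beta _ _ _
  | _ => simp only [Tm.subst]; constructor <;> solve_by_elim

theorem Conv.subst {M N : Tm} (h : Conv M N) (f : ℕ → Tm) :
    Conv (Tm.subst f M) (Tm.subst f N) :=
  Conv.map (fun _ _ s => .of_step (s.subst f)) h

theorem Conv.shift {M N : Tm} (h : Conv M N) (k : ℕ) : Conv (Tm.shift k M) (Tm.shift k N) := by
  simpa only [Tm.shift, rename_eq_subst] using h.subst _

theorem Conv.liftSub {f g : ℕ → Tm} (h : ∀ n, Conv (f n) (g n)) (n : ℕ) :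
    Conv (Tm.liftSub f n) (Tm.liftSub g n) := by
  cases n with
  | zero => exact .rfl'
  | succ n => exact (h n).shift 1

/-- Convertible substitutions have convertible results. -/
theorem Conv.subst_congr (M : Tm) {f g : ℕ → Tm} (h : ∀ n, Conv (f n) (g n)) :
    Conv (Tm.subst f M) (Tm.subst g M) := by
  induction M generalizing f g with
  | srt s => exact .rfl'
  | var n => exact h n
  | pi U T ih₁ ih₂ => exact .pi (ih₁ h) (ih₂ (Conv.liftSub h))
  | lam U T ih₁ ih₂ => exact .lam (ih₁ h) (ih₂ (Conv.liftSub h))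
  | app U T ih₁ ih₂ => exact .app (ih₁ h) (ih₂ h)
  | idt σ a b ih₁ ih₂ ih₃ => exact .idt (ih₁ h) (ih₂ h) (ih₃ h)
  | refl => exact .rfl'
  | J c a b q ih₁ ih₂ ih₃ ih₄ => exact .J (ih₁ h) (ih₂ h) (ih₃ h) (ih₄ h)
  | sig U T ih₁ ih₂ => exact .sig (ih₁ h) (ih₂ (Conv.liftSub h))
  | pair U T ih₁ ih₂ => exact .pair (ih₁ h) (ih₂ h)
  | fst p ih => exact .fst (ih h)
  | snd p ih => exact .snd (ih h)
  | uip => exact .rfl'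

theorem Conv.inst {a a' b b' : Tm} (ha : Conv a a') (hb : Conv b b') :
    Conv (Tm.inst a b) (Tm.inst a' b') :=
  (hb.subst _).trans' (Conv.subst_congr _ fun n => by
    cases n with
    | zero => exact ha
    | succ n => exact .rfl')

/-! ### Parallel reduction and the Church–Rosser property. -/

/-- Parallel reduction, where the rule for `J` is left-linear with a convertibility condition. -/
inductive Par : Tm → Tm → Prop
  | srt (s : Srt) : Par (srt s) (srt s)
  | var (n : ℕ) : Par (var n) (var n)
  | pi {U U' T T' : Tm} : Par U U' → Par T T' → Par (pi U T) (pi U' T')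
  | lam {U U' b b' : Tm} : Par U U' → Par b b' → Par (lam U b) (lam U' b')
  | app {f f' a a' : Tm} : Par f f' → Par a a' → Par (app f a) (app f' a')
  | idt {σ σ' a a' b b' : Tm} : Par σ σ' → Par a a' → Par b b' → Par (idt σ a b) (idt σ' a' b')
  | refl : Par refl refl
  | J {c c' a a' b b' q q' : Tm} :
      Par c c' → Par a a' → Par b b' → Par q q' → Par (J c a b q) (J c' a' b' q')
  | sig {U U' T T' : Tm} : Par U U' → Par T T' → Par (sig U T) (sig U' T')
  | pair {a a' b b' : Tm} : Par a a' → Par b b' → Par (pair a b) (pair a' b')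
  | fst {p p' : Tm} : Par p p' → Par (fst p) (fst p')
  | snd {p p' : Tm} : Par p p' → Par (snd p) (snd p')
  | uip : Par uip uip
  | beta (U : Tm) {b b' a a' : Tm} : Par b b' → Par a a' → Par (app (lam U b) a) (inst a' b')
  | J_refl {c c' a a' b : Tm} :
      Par c c' → Par a a' → Conv a b → Par (J c a b refl) (app c' a')
  | fst_pair {a a' : Tm} (b : Tm) : Par a a' → Par (fst (pair a b)) a'
  | snd_pair (a : Tm) {b b' : Tm} : Par b b' → Par (snd (pair a b)) b'

namespace Par

theorem rfl' (M : Tm) : Par M M := by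
  induction M <;> constructor <;> assumption

theorem of_step {M N : Tm} (h : Step M N) : Par M N := by
  induction h with
  | beta U b a => exact .beta U (rfl' _) (rfl' _)
  | J_refl c a => exact .J_refl (rfl' _) (rfl' _) .rfl'
  | fst_pair a b => exact .fst_pair b (rfl' _)
  | snd_pair a b => exact .snd_pair a (rfl' _)
  | _ => constructor <;> first | assumption | exact rfl' _

theorem conv {M N : Tm} (h : Par M N) : Conv M N := by
  induction h with
  | srt | var | refl | uip => exact .rfl'
  | pi _ _ h₁ h₂ => exact .pi h₁ h₂
  | lam _ _ h₁ h₂ => exact .lam h₁ h₂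
  | app _ _ h₁ h₂ => exact .app h₁ h₂
  | idt _ _ _ h₁ h₂ h₃ => exact .idt h₁ h₂ h₃
  | J _ _ _ _ h₁ h₂ h₃ h₄ => exact .J h₁ h₂ h₃ h₄
  | sig _ _ h₁ h₂ => exact .sig h₁ h₂
  | pair _ _ h₁ h₂ => exact .pair h₁ h₂
  | fst _ h => exact .fst h
  | snd _ h => exact .snd h
  | beta U _ _ h₁ h₂ => exact (Conv.of_step (.beta U _ _)).trans' (.inst h₂ h₁)
  | J_refl _ _ h h₁ h₂ =>
    -- The second endpoint is first converted back to the first one, after which the official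
    -- non-linear rule applies.
    exact ((Conv.J .rfl' .rfl' h.symm' .rfl').trans' (.of_step (.J_refl _ _))).trans' (.app h₁ h₂)
  | fst_pair b _ h => exact (Conv.of_step (.fst_pair _ b)).trans' h
  | snd_pair a _ h => exact (Conv.of_step (.snd_pair a _)).trans' h

theorem rename {M N : Tm} (h : Par M N) (r : ℕ → ℕ) : Par (Tm.rename r M) (Tm.rename r N) := by
  induction h generalizing r with
  | beta U _ _ h₁ h₂ =>
    rw [rename_inst]; exact .beta _ (h₁ _) (h₂ r)
  | J_refl _ _ h h₁ h₂ =>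
    exact .J_refl (h₁ r) (h₂ r) (by simpa only [rename_eq_subst] using h.subst _)
  | fst_pair b _ h => exact .fst_pair _ (h r)
  | snd_pair b _ h => exact .snd_pair _ (h r)
  | _ => simp only [Tm.rename]; constructor <;> solve_by_elim

theorem liftSub {f g : ℕ → Tm} (h : ∀ n, Par (f n) (g n)) (n : ℕ) :
    Par (Tm.liftSub f n) (Tm.liftSub g n) := by
  cases n with
  | zero => exact .var 0
  | succ n => exact (h n).rename _

theorem subst {M N : Tm} (h : Par M N) {f g : ℕ → Tm} (hfg : ∀ n, Par (f n) (g n)) :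
    Par (Tm.subst f M) (Tm.subst g N) := by
  induction h generalizing f g with
  | beta U _ _ h₁ h₂ => rw [subst_inst]; exact .beta _ (h₁ (Par.liftSub hfg)) (h₂ hfg)
  | J_refl _ _ h h₁ h₂ => exact .J_refl (h₁ hfg) (h₂ hfg) (h.subst _)
  | fst_pair b _ h => exact .fst_pair _ (h hfg)
  | snd_pair b _ h => exact .snd_pair _ (h hfg)
  | var n => exact hfg n
  | pi _ _ h₁ h₂ => exact .pi (h₁ hfg) (h₂ (Par.liftSub hfg))
  | lam _ _ h₁ h₂ => exact .lam (h₁ hfg) (h₂ (Par.liftSub hfg))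
  | sig _ _ h₁ h₂ => exact .sig (h₁ hfg) (h₂ (Par.liftSub hfg))
  | _ => simp only [Tm.subst]; constructor <;> solve_by_elim

theorem inst {a a' b b' : Tm} (ha : Par a a') (hb : Par b b') :
    Par (Tm.inst a b) (Tm.inst a' b') :=
  hb.subst fun n => by
    cases n with
    | zero => exact ha
    | succ n => exact .var n

/-- The `J`-rule repeats a variable, so a strict syntactic test would be destroyed when the two
copies reduce differently. Testing up to `Conv` survives independent reduction of both sides,
because parallel reduction is contained in conversion; the remaining overlaps are the usual ones. -/
theorem diamond {M N₁ N₂ : Tm} (h₁ : Par M N₁) (h₂ : Par M N₂) : ∃ Q, Par N₁ Q ∧ Par N₂ Q := by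
  induction h₁ generalizing N₂ with
  | srt s => exact ⟨_, h₂, rfl' _⟩
  | var n => exact ⟨_, h₂, rfl' _⟩
  | refl => exact ⟨_, h₂, rfl' _⟩
  | uip => exact ⟨_, h₂, rfl' _⟩
  | pi _ _ ih ih' =>
    cases h₂ with
    | pi k k' =>
      obtain ⟨Q, q₁, q₂⟩ := ih k
      obtain ⟨R, r₁, r₂⟩ := ih' k'
      exact ⟨_, .pi q₁ r₁, .pi q₂ r₂⟩
  | lam _ _ ih ih' =>
    cases h₂ with
    | lam k k' =>
      obtain ⟨Q, q₁, q₂⟩ := ih k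
      obtain ⟨R, r₁, r₂⟩ := ih' k'
      exact ⟨_, .lam q₁ r₁, .lam q₂ r₂⟩
  | sig _ _ ih ih' =>
    cases h₂ with
    | sig k k' =>
      obtain ⟨Q, q₁, q₂⟩ := ih k
      obtain ⟨R, r₁, r₂⟩ := ih' k'
      exact ⟨_, .sig q₁ r₁, .sig q₂ r₂⟩
  | pair _ _ ih ih' =>
    cases h₂ with
    | pair k k' =>
      obtain ⟨Q, q₁, q₂⟩ := ih k
      obtain ⟨R, r₁, r₂⟩ := ih' k'
      exact ⟨_, .pair q₁ r₁, .pair q₂ r₂⟩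
  | idt _ _ _ ih ih' ih'' =>
    cases h₂ with
    | idt k k' k'' =>
      obtain ⟨Q, q₁, q₂⟩ := ih k
      obtain ⟨R, r₁, r₂⟩ := ih' k'
      obtain ⟨S, s₁, s₂⟩ := ih'' k''
      exact ⟨_, .idt q₁ r₁ s₁, .idt q₂ r₂ s₂⟩
  | app h h' ih ih' =>
    cases h₂ with
    | app k k' =>
      obtain ⟨Q, q₁, q₂⟩ := ih k
      obtain ⟨R, r₁, r₂⟩ := ih' k'
      exact ⟨_, .app q₁ r₁, .app q₂ r₂⟩
    | beta U k k' =>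
      obtain ⟨Q, q₁, q₂⟩ := ih (.lam (rfl' U) k)
      obtain ⟨R, r₁, r₂⟩ := ih' k'
      cases h with
      | lam _ _ =>
        cases q₁ with
        | lam _ q₁ =>
          cases q₂ with
          | lam _ q₂ => exact ⟨_, .beta _ q₁ r₁, .inst r₂ q₂⟩
  | beta U _ _ ih ih' =>
    cases h₂ with
    | app k k' =>
      cases k with
      | lam _ k =>
        obtain ⟨Q, q₁, q₂⟩ := ih k
        obtain ⟨R, r₁, r₂⟩ := ih' k'
        exact ⟨_, .inst r₁ q₁, .beta _ q₂ r₂⟩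
    | beta _ k k' =>
      obtain ⟨Q, q₁, q₂⟩ := ih k
      obtain ⟨R, r₁, r₂⟩ := ih' k'
      exact ⟨_, .inst r₁ q₁, .inst r₂ q₂⟩
  | J h₁ h₂' h₃ h₄ ih₁ ih₂ ih₃ ih₄ =>
    cases h₂ with
    | J k₁ k₂ k₃ k₄ =>
      obtain ⟨Q, q₁, q₂⟩ := ih₁ k₁
      obtain ⟨R, r₁, r₂⟩ := ih₂ k₂
      obtain ⟨S, s₁, s₂⟩ := ih₃ k₃
      obtain ⟨T, t₁, t₂⟩ := ih₄ k₄
      exact ⟨_, .J q₁ r₁ s₁ t₁, .J q₂ r₂ s₂ t₂⟩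
    | J_refl k₁ k₂ e =>
      obtain ⟨Q, q₁, q₂⟩ := ih₁ k₁
      obtain ⟨R, r₁, r₂⟩ := ih₂ k₂
      cases h₄
      exact ⟨_, .J_refl q₁ r₁ ((h₂'.conv.symm'.trans' e).trans' h₃.conv), .app q₂ r₂⟩
  | J_refl h₁ h₂' e ih₁ ih₂ =>
    cases h₂ with
    | J k₁ k₂ k₃ k₄ =>
      obtain ⟨Q, q₁, q₂⟩ := ih₁ k₁
      obtain ⟨R, r₁, r₂⟩ := ih₂ k₂
      cases k₄
      exact ⟨_, .app q₁ r₁, .J_refl q₂ r₂ ((k₂.conv.symm'.trans' e).trans' k₃.conv)⟩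
    | J_refl k₁ k₂ _ =>
      obtain ⟨Q, q₁, q₂⟩ := ih₁ k₁
      obtain ⟨R, r₁, r₂⟩ := ih₂ k₂
      exact ⟨_, .app q₁ r₁, .app q₂ r₂⟩
  | fst h ih =>
    cases h₂ with
    | fst k =>
      obtain ⟨Q, q₁, q₂⟩ := ih k
      exact ⟨_, .fst q₁, .fst q₂⟩
    | fst_pair b k =>
      obtain ⟨Q, q₁, q₂⟩ := ih (.pair k (rfl' b))
      cases h with
      | pair _ _ =>
        cases q₁ with
        | pair q₁ _ =>
          cases q₂ with
          | pair q₂ _ => exact ⟨_, .fst_pair _ q₁, q₂⟩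
  | snd h ih =>
    cases h₂ with
    | snd k =>
      obtain ⟨Q, q₁, q₂⟩ := ih k
      exact ⟨_, .snd q₁, .snd q₂⟩
    | snd_pair b k =>
      obtain ⟨Q, q₁, q₂⟩ := ih (.pair (rfl' b) k)
      cases h with
      | pair _ _ =>
        cases q₁ with
        | pair _ q₁ =>
          cases q₂ with
          | pair _ q₂ => exact ⟨_, .snd_pair _ q₁, q₂⟩
  | fst_pair b _ ih =>
    cases h₂ with
    | fst k =>
      cases k with
      | pair k _ =>
        obtain ⟨Q, q₁, q₂⟩ := ih k
        exact ⟨_, q₁, .fst_pair _ q₂⟩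
    | fst_pair _ k => exact ih k
  | snd_pair b _ ih =>
    cases h₂ with
    | snd k =>
      cases k with
      | pair _ k =>
        obtain ⟨Q, q₁, q₂⟩ := ih k
        exact ⟨_, q₁, .snd_pair _ q₂⟩
    | snd_pair _ k => exact ih k

end Par

/-- Iterated parallel reduction. -/
abbrev Pars : Tm → Tm → Prop := Relation.ReflTransGen Par

theorem Pars.conv {M N : Tm} (h : Pars M N) : Conv M N := by
  induction h with
  | refl => exact .rfl'
  | tail _ h ih => exact ih.trans' h.conv

/-- The Church–Rosser property. -/
theorem Conv.join {M N : Tm} (h : Conv M N) : ∃ Q, Pars M Q ∧ Pars N Q := by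
  have cr : ∀ {a b c : Tm}, Pars a b → Pars a c → Relation.Join Pars b c :=
    Relation.church_rosser fun a b c hab hac =>
      let ⟨Q, h₁, h₂⟩ := hab.diamond hac
      ⟨Q, .single h₁, .single h₂⟩
  induction h with
  | rel _ _ h => exact ⟨_, .single (.of_step h), .refl⟩
  | refl _ => exact ⟨_, .refl, .refl⟩
  | symm _ _ _ ih => exact let ⟨Q, h₁, h₂⟩ := ih; ⟨Q, h₂, h₁⟩
  | trans _ _ _ _ _ ih₁ ih₂ =>
    obtain ⟨Q, q₁, q₂⟩ := ih₁
    obtain ⟨R, r₁, r₂⟩ := ih₂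
    obtain ⟨S, s₁, s₂⟩ := cr q₂ r₁
    exact ⟨S, q₁.trans s₁, r₂.trans s₂⟩

theorem Pars.pi_inv {U T Q : Tm} (h : Pars (pi U T) Q) :
    ∃ U' T', Q = pi U' T' ∧ Pars U U' ∧ Pars T T' := by
  induction h with
  | refl => exact ⟨_, _, rfl, .refl, .refl⟩
  | tail _ h ih =>
    obtain ⟨U', T', rfl, hU, hT⟩ := ih
    cases h with
    | pi h h' => exact ⟨_, _, rfl, hU.tail h, hT.tail h'⟩

theorem Pars.srt_inv {s : Srt} {Q : Tm} (h : Pars (srt s) Q) : Q = srt s := by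
  induction h with
  | refl => rfl
  | tail _ h ih => subst ih; cases h; rfl

theorem Pars.var_inv {n : ℕ} {Q : Tm} (h : Pars (var n) Q) : Q = var n := by
  induction h with
  | refl => rfl
  | tail _ h ih => subst ih; cases h; rfl

/-- Products reduce only to products, componentwise, so a common reduct can be compared component by
component. This is what moves computability between convertible kinds. -/
theorem Conv.pi_inj {U U' T T' : Tm} (h : Conv (Tm.pi U T) (Tm.pi U' T')) :
    Conv U U' ∧ Conv T T' := by
  obtain ⟨Q, h₁, h₂⟩ := h.join
  obtain ⟨_, _, rfl, a, b⟩ := h₁.pi_inv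
  obtain ⟨_, _, e, c, d⟩ := h₂.pi_inv
  cases e
  exact ⟨a.conv.trans' c.conv.symm', b.conv.trans' d.conv.symm'⟩

theorem not_conv_var {m n : ℕ} (h : m ≠ n) : ¬ Conv (var m) (var n) := by
  intro hc
  obtain ⟨Q, h₁, h₂⟩ := hc.join
  have := h₁.var_inv.symm.trans h₂.var_inv
  exact h (Tm.var.inj this)

/-! ### Coarse classification of constructors and kinds. -/

/-- The sequence with first entry `a` followed by `f`. -/
def ncons {α : Type*} (a : α) (f : ℕ → α) : ℕ → α
  | 0 => a
  | n + 1 => f n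

/-- Coarse classes: constructors and kinds with a given number of arguments. -/
inductive Cls : Type
  | con : ℕ → Cls
  | knd : ℕ → Cls

/-- Coarse classification of constructors and kinds. Objects are not inspected; the context
records the number of arguments of each constructor variable. -/
inductive Cs : (ℕ → Option ℕ) → Cls → Tm → Prop
  | star {Δ} : Cs Δ (.knd 0) star
  | var {Δ i n} : Δ i = some n → Cs Δ (.con n) (var i)
  | piObj {Δ U T} : Cs Δ (.con 0) U → Cs (ncons none Δ) (.con 0) T → Cs Δ (.con 0) (pi U T)
  | piKnd {Δ k U T} :
      Cs Δ (.knd k) U → Cs (ncons (some k) Δ) (.con 0) T → Cs Δ (.con 0) (pi U T)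
  | kndPi {Δ n U T} : Cs Δ (.con 0) U → Cs (ncons none Δ) (.knd n) T → Cs Δ (.knd (n + 1)) (pi U T)
  | lam {Δ n U b} : Cs (ncons none Δ) (.con n) b → Cs Δ (.con (n + 1)) (lam U b)
  | app {Δ n F a} : Cs Δ (.con (n + 1)) F → Cs Δ (.con n) (app F a)
  | idt {Δ σ a b} : Cs Δ (.con 0) σ → Cs Δ (.con 0) (idt σ a b)
  | sig {Δ σ τ} : Cs Δ (.con 0) σ → Cs (ncons none Δ) (.con 0) τ → Cs Δ (.con 0) (sig σ τ)

namespace Cs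

theorem rename {Δ Δ' : ℕ → Option ℕ} {c : Cls} {M : Tm} {r : ℕ → ℕ} (h : Cs Δ c M)
    (hr : ∀ n k, Δ n = some k → Δ' (r n) = some k) : Cs Δ' c (Tm.rename r M) := by
  have lift : ∀ {Δ Δ' : ℕ → Option ℕ} {r : ℕ → ℕ} (d : Option ℕ),
      (∀ n k, Δ n = some k → Δ' (r n) = some k) →
      ∀ n k, ncons d Δ n = some k → ncons d Δ' (liftRen r n) = some k := by
    intro Δ Δ' r d h n k
    cases n with
    | zero => exact id
    | succ n => exact h n k
  induction h generalizing Δ' r with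
  | star => exact .star
  | var h => exact .var (hr _ _ h)
  | piObj _ _ ih ih' => exact .piObj (ih hr) (ih' (lift _ hr))
  | piKnd _ _ ih ih' => exact .piKnd (ih hr) (ih' (lift _ hr))
  | kndPi _ _ ih ih' => exact .kndPi (ih hr) (ih' (lift _ hr))
  | lam _ ih => exact .lam (ih (lift _ hr))
  | app _ ih => exact .app (ih hr)
  | idt _ ih => exact .idt (ih hr)
  | sig _ _ ih ih' => exact .sig (ih hr) (ih' (lift _ hr))

theorem shift {Δ : ℕ → Option ℕ} {c : Cls} {M : Tm} (h : Cs Δ c M) (d : Option ℕ) :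
    Cs (ncons d Δ) c (Tm.shift 1 M) :=
  h.rename fun _ _ => id

theorem subst {Δ Δ' : ℕ → Option ℕ} {c : Cls} {M : Tm} {f : ℕ → Tm} (h : Cs Δ c M)
    (hf : ∀ n k, Δ n = some k → Cs Δ' (.con k) (f n)) : Cs Δ' c (Tm.subst f M) := by
  have lift : ∀ {Δ Δ' : ℕ → Option ℕ} {f : ℕ → Tm} (d : Option ℕ),
      (∀ n k, Δ n = some k → Cs Δ' (.con k) (f n)) →
      ∀ n k, ncons d Δ n = some k → Cs (ncons d Δ') (.con k) (liftSub f n) := by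
    intro Δ Δ' r d h n k hn
    cases n with
    | zero => exact .var hn
    | succ n => exact (h n k hn).shift d
  induction h generalizing Δ' f with
  | star => exact .star
  | var h => exact hf _ _ h
  | piObj _ _ ih ih' => exact .piObj (ih hf) (ih' (lift _ hf))
  | piKnd _ _ ih ih' => exact .piKnd (ih hf) (ih' (lift _ hf))
  | kndPi _ _ ih ih' => exact .kndPi (ih hf) (ih' (lift _ hf))
  | lam _ ih => exact .lam (ih (lift _ hf))
  | app _ ih => exact .app (ih hf)
  | idt _ ih => exact .idt (ih hf)
  | sig _ _ ih ih' => exact .sig (ih hf) (ih' (lift _ hf))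

/-- The argument is arbitrary because a classification never looks up a variable whose entry is
`none`. -/
theorem inst_obj {Δ : ℕ → Option ℕ} {c : Cls} {T : Tm} (h : Cs (ncons none Δ) c T) (a : Tm) :
    Cs Δ c (inst a T) :=
  h.subst fun n k hn => by
    cases n with
    | zero => cases hn
    | succ n => exact .var hn

theorem inst_con {Δ : ℕ → Option ℕ} {c : Cls} {T a : Tm} {k : ℕ} (h : Cs (ncons (some k) Δ) c T)
    (ha : Cs Δ (.con k) a) : Cs Δ c (inst a T) :=
  h.subst fun n k hn => by
    cases n with
    | zero => cases hn; exact ha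
    | succ n => exact .var hn

theorem unique {Δ : ℕ → Option ℕ} {c c' : Cls} {M : Tm} (h : Cs Δ c M) (h' : Cs Δ c' M) :
    c = c' := by
  induction h generalizing c' with
  | star => cases h'; rfl
  | var h => cases h' with | var h' => rw [h] at h'; cases h'; rfl
  | piObj _ _ ih ih' =>
    cases h' with
    | piObj _ _ => rfl
    | piKnd _ _ => rfl
    | kndPi _ k => cases ih' k
  | piKnd _ _ ih ih' =>
    cases h' with
    | piObj _ _ => rfl
    | piKnd _ _ => rfl
    | kndPi k _ => cases ih k
  | kndPi _ _ ih ih' =>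
    cases h' with
    | piObj _ k => cases ih' k
    | piKnd k _ => cases ih k
    | kndPi _ k => cases ih' k; rfl
  | lam _ ih => cases h' with | lam k => cases ih k; rfl
  | app _ ih => cases h' with | app k => cases ih k; rfl
  | idt _ ih => cases h'; rfl
  | sig _ _ _ _ => cases h'; rfl

theorem par {Δ : ℕ → Option ℕ} {c : Cls} {M N : Tm} (h : Cs Δ c M) (hp : Par M N) :
    Cs Δ c N := by
  induction h generalizing N with
  | star => cases hp; exact .star
  | var h => cases hp; exact .var h
  | piObj _ _ ih ih' => cases hp with | pi p q => exact .piObj (ih p) (ih' q)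
  | piKnd _ _ ih ih' => cases hp with | pi p q => exact .piKnd (ih p) (ih' q)
  | kndPi _ _ ih ih' => cases hp with | pi p q => exact .kndPi (ih p) (ih' q)
  | lam _ ih => cases hp with | lam _ q => exact .lam (ih q)
  | app h ih =>
    cases hp with
    | app p q => exact .app (ih p)
    -- Since a classified abstraction binds an object variable, contracting it needs no information
    -- on the argument.
    | beta U p q => cases ih (.lam (.rfl' U) p) with | lam k => exact k.inst_obj _
  | idt _ ih => cases hp with | idt p _ _ => exact .idt (ih p)
  | sig _ _ ih ih' => cases hp with | sig p q => exact .sig (ih p) (ih' q)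

theorem pars {Δ : ℕ → Option ℕ} {c : Cls} {M N : Tm} (h : Cs Δ c M) (hp : Pars M N) :
    Cs Δ c N := by
  induction hp with
  | refl => exact h
  | tail _ hp ih => exact ih.par hp

theorem eq_of_conv {Δ : ℕ → Option ℕ} {c c' : Cls} {M N : Tm} (h : Cs Δ c M) (h' : Cs Δ c' N)
    (hc : Conv M N) : c = c' :=
  let ⟨_, p, q⟩ := hc.join
  (h.pars p).unique (h'.pars q)

theorem not_conv_kind {Δ : ℕ → Option ℕ} {c : Cls} {M : Tm} (h : Cs Δ c M) :
    ¬ Conv (srt .kind) M := by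
  intro hc
  obtain ⟨Q, p, q⟩ := hc.join
  have := h.pars q
  rw [p.srt_inv] at this
  cases this

theorem inst3 {Δ : ℕ → Option ℕ} {c : Cls} {τ : Tm}
    (h : Cs (ncons none (ncons none (ncons none Δ))) c τ) (a b q : Tm) :
    Cs Δ c (Tm.inst3 a b q τ) :=
  h.subst fun n k hn => by
    rcases n with _ | _ | _ | n
    · cases hn
    · cases hn
    · cases hn
    · exact .var hn

end Cs

/-- The coarse context of a context. -/
inductive CtxC : List Tm → (ℕ → Option ℕ) → Prop
  | nil : CtxC [] fun _ => none
  | obj {Γ Δ T} : CtxC Γ Δ → Cs Δ (.con 0) T → CtxC (T :: Γ) (ncons none Δ)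
  | knd {Γ Δ T k} : CtxC Γ Δ → Cs Δ (.knd k) T → CtxC (T :: Γ) (ncons (some k) Δ)

theorem CtxC.unique {Γ : List Tm} {Δ Δ' : ℕ → Option ℕ} (h : CtxC Γ Δ) (h' : CtxC Γ Δ') :
    Δ = Δ' := by
  induction h generalizing Δ' with
  | nil => cases h'; rfl
  | obj _ k ih =>
    cases h' with
    | obj h' k' => rw [ih h']
    | knd h' k' => cases ih h'; cases k.unique k'
  | knd _ k ih =>
    cases h' with
    | obj h' k' => cases ih h'; cases k.unique k'
    | knd h' k' => cases ih h'; cases k.unique k'; rfl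

/-- The coarse counterpart of typing. -/
inductive HasCls (Δ : ℕ → Option ℕ) (M : Tm) : Tm → Prop
  | kind {n} : Cs Δ (.knd n) M → HasCls Δ M (srt .kind)
  | con {T n} : Cs Δ (.knd n) T → Cs Δ (.con n) M → HasCls Δ M T
  | obj {T} : Cs Δ (.con 0) T → HasCls Δ M T

theorem HasCls.star_inv {Δ : ℕ → Option ℕ} {T : Tm} (h : HasCls Δ T star) : Cs Δ (.con 0) T := by
  cases h with
  | con h h' => cases h; exact h'
  | obj h => cases h

theorem HasCls.kind_inv {Δ : ℕ → Option ℕ} {T : Tm} (h : HasCls Δ T (srt .kind)) :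
    ∃ n, Cs Δ (.knd n) T := by
  cases h with
  | kind h => exact ⟨_, h⟩
  | con h => cases h
  | obj h => cases h

theorem HasCls.srt_inv {Δ : ℕ → Option ℕ} {T : Tm} {s : Srt} (h : HasCls Δ T (srt s)) :
    ∃ c, Cs Δ c T := by
  cases s with
  | star => exact ⟨_, h.star_inv⟩
  | kind => exact let ⟨n, h⟩ := h.kind_inv; ⟨_, h⟩

theorem HasCls.con_of_knd {Δ : ℕ → Option ℕ} {M T : Tm} {n : ℕ} (h : HasCls Δ M T)
    (hT : Cs Δ (.knd n) T) : Cs Δ (.con n) M := by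
  cases h with
  | kind _ => cases hT
  | con h h' => cases h.unique hT; exact h'
  | obj h => cases h.unique hT

theorem HasCls.shift {Δ : ℕ → Option ℕ} {M T : Tm} (h : HasCls Δ M T) (d : Option ℕ) :
    HasCls (ncons d Δ) (shift 1 M) (shift 1 T) := by
  cases h with
  | kind h => exact .kind (h.shift d)
  | con h h' => exact .con (h.shift d) (h'.shift d)
  | obj h => exact .obj (h.shift d)

theorem CtxC.ext {Γ : List Tm} {Δ : ℕ → Option ℕ} {T : Tm} {s : Srt} (h : CtxC Γ Δ)
    (hT : HasCls Δ T (srt s)) : ∃ d, CtxC (T :: Γ) (ncons d Δ) ∧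
      ((d = none ∧ Cs Δ (.con 0) T) ∨ ∃ k, d = some k ∧ Cs Δ (.knd k) T) := by
  cases s with
  | star => exact ⟨_, h.obj hT.star_inv, .inl ⟨rfl, hT.star_inv⟩⟩
  | kind => obtain ⟨n, hn⟩ := hT.kind_inv; exact ⟨_, h.knd hn, .inr ⟨n, rfl, hn⟩⟩

/-- Supplies the class information under which interpretations respect conversion. Subject reduction
for the typing system is not needed: the conversion rule is handled by `Cs.eq_of_conv`, which rests
on Church–Rosser for pseudo-terms. -/
theorem Typed.hasCls {Γ : List Tm} {M T : Tm} (h : Typed Γ M T) :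
    ∃ Δ, CtxC Γ Δ ∧ HasCls Δ M T := by
  induction h with
  | ax => exact ⟨_, .nil, .kind .star⟩
  | var _ ih =>
    obtain ⟨Δ, hΔ, h⟩ := ih
    obtain ⟨d, hd, ⟨rfl, k⟩ | ⟨k, rfl, hk⟩⟩ := hΔ.ext h
    · exact ⟨_, hd, .obj (k.shift _)⟩
    · exact ⟨_, hd, .con (hk.shift _) (.var rfl)⟩
  | weak _ _ ih ih' =>
    obtain ⟨Δ, hΔ, h⟩ := ih
    obtain ⟨Δ', hΔ', h'⟩ := ih'
    cases hΔ.unique hΔ'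
    obtain ⟨d, hd, _⟩ := hΔ.ext h'
    exact ⟨_, hd, h.shift d⟩
  | conv _ _ hc ih ih' =>
    obtain ⟨Δ, hΔ, h⟩ := ih
    obtain ⟨Δ', hΔ', h'⟩ := ih'
    cases hΔ.unique hΔ'
    obtain ⟨c, hU⟩ := h'.srt_inv
    refine ⟨_, hΔ, ?_⟩
    cases h with
    | kind h => exact absurd hc hU.not_conv_kind
    | con h k => cases h.eq_of_conv hU hc; exact .con hU k
    | obj h => cases h.eq_of_conv hU hc; exact .obj hU
  | @pi Γ U T s₁ s₂ hs _ _ ih ih' =>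
    obtain ⟨Δ, hΔ, h⟩ := ih
    obtain ⟨Δ', hΔ', h'⟩ := ih'
    refine ⟨_, hΔ, ?_⟩
    cases hΔ' with
    | obj hΔ' k =>
      cases hΔ.unique hΔ'
      cases s₂ with
      | star => exact .con .star (.piObj k h'.star_inv)
      | kind => obtain ⟨n, hn⟩ := h'.kind_inv; exact .kind (.kndPi k hn)
    | knd hΔ' k =>
      cases hΔ.unique hΔ'
      cases s₂ with
      | star => exact .con .star (.piKnd k h'.star_inv)
      | kind =>
        cases s₁ with
        -- Here the domain is a kind and the codomain too: the first case contradicts uniqueness of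
        -- classes, the second is the excluded pair of sorts.
        | star => cases h.star_inv.unique k
        | kind => exact absurd ⟨rfl, rfl⟩ hs
  | @lam Γ U T b s _ _ ih ih' =>
    obtain ⟨Δ, hΔ, h⟩ := ih
    obtain ⟨Δ', hΔ', h'⟩ := ih'
    refine ⟨_, hΔ, ?_⟩
    cases s with
    | star => exact .obj h.star_inv
    | kind =>
      obtain ⟨n, hn⟩ := h.kind_inv
      cases hn with
      | kndPi hU hT =>
        cases hΔ'.unique (hΔ.obj hU)
        exact .con (.kndPi hU hT) (.lam (h'.con_of_knd hT))
  | app _ _ ih ih' =>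
    obtain ⟨Δ, hΔ, h⟩ := ih
    obtain ⟨Δ', hΔ', h'⟩ := ih'
    cases hΔ.unique hΔ'
    refine ⟨_, hΔ, ?_⟩
    cases h with
    | con h k => cases h with | kndPi hU hT => exact .con (hT.inst_obj _) (.app k)
    | obj h =>
      cases h with
      | piObj hU hT => exact .obj (hT.inst_obj _)
      | piKnd hU hT => exact .obj (hT.inst_con (h'.con_of_knd hU))
  | idt _ _ _ ih _ _ =>
    obtain ⟨Δ, hΔ, h⟩ := ih
    exact ⟨_, hΔ, .con .star (.idt h.star_inv)⟩
  | refl _ _ ih _ =>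
    obtain ⟨Δ, hΔ, h⟩ := ih
    exact ⟨_, hΔ, .obj (.idt h.star_inv)⟩
  | J _ _ _ _ _ _ _ ih ih' _ =>
    obtain ⟨Δ, hΔ, h⟩ := ih
    obtain ⟨Δ', hΔ', h'⟩ := ih'
    refine ⟨_, hΔ, ?_⟩
    cases h with
    | con h _ => cases h
    | obj h =>
      cases h with
      | idt h =>
        cases hΔ'.unique (((hΔ.obj h).obj (h.shift none)).obj
          (.idt (by simpa [Tm.shift, rename_rename] using (h.shift none).shift none)))
        exact .obj (h'.star_inv.inst3 _ _ _)
  | sig _ _ ih ih' =>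
    obtain ⟨Δ, hΔ, h⟩ := ih
    obtain ⟨Δ', hΔ', h'⟩ := ih'
    cases hΔ'.unique (hΔ.obj h.star_inv)
    exact ⟨_, hΔ, .con .star (.sig h.star_inv h'.star_inv)⟩
  | pair _ _ _ ih _ _ =>
    obtain ⟨Δ, hΔ, h⟩ := ih
    exact ⟨_, hΔ, .obj h.star_inv⟩
  | fst _ ih =>
    obtain ⟨Δ, hΔ, h⟩ := ih
    refine ⟨_, hΔ, ?_⟩
    cases h with
    | con h _ => cases h
    | obj h => cases h with | sig h _ => exact .obj h
  | snd _ ih =>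
    obtain ⟨Δ, hΔ, h⟩ := ih
    refine ⟨_, hΔ, ?_⟩
    cases h with
    | con h _ => cases h
    | obj h => cases h with | sig _ h => exact .obj (h.inst_obj _)
  | uip =>
    refine ⟨_, .nil, .obj (.piKnd .star (.piObj (.var rfl) (.piObj (.var rfl) ?_)))⟩
    exact .piObj (.idt (.var rfl)) (.piObj (.idt (.var rfl)) (.idt (.idt (.var rfl))))

/-! ### Erasure to realizers. -/

theorem Tm.inst_shift (a M : Tm) : inst a (shift 1 M) = M := by
  rw [inst, subst_scons_shift, subst_var]

namespace Tm

/-- Realizer of the first projection of an encoded pair. -/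
def sel₁ : Tm := lam star (lam star (var 1))

/-- Realizer of the second projection of an encoded pair. -/
def sel₂ : Tm := lam star (lam star (var 0))

/-- The realizer of a term: type information is erased, pairs are encoded by functions and proofs
of identities are trivial. -/
def tr : Tm → Tm
  | srt _ => star
  | var n => var n
  | pi _ _ => star
  | lam _ b => lam star (tr b)
  | app f a => app (tr f) (tr a)
  | idt _ _ _ => star
  | refl => refl
  | J c a _ _ => app (tr c) (tr a)
  | sig _ _ => star
  | pair a b => lam star (app (app (var 0) (shift 1 (tr a))) (shift 1 (tr b)))
  | fst p => app (tr p) sel₁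
  | snd p => app (tr p) sel₂
  | uip => lam star (lam star (lam star (lam star (lam star refl))))

theorem subst_sel₁ (f : ℕ → Tm) : subst f sel₁ = sel₁ := rfl

theorem subst_sel₂ (f : ℕ → Tm) : subst f sel₂ = sel₂ := rfl

theorem liftSub_zero (f : ℕ → Tm) : liftSub f 0 = var 0 := rfl

theorem tr_rename (M : Tm) (r : ℕ → ℕ) : tr (rename r M) = rename r (tr M) := by
  induction M generalizing r <;>
    simp [tr, rename, sel₁, sel₂, liftRen, liftRen_eq_succ, *]

theorem tr_liftSub (f : ℕ → Tm) : (fun n => tr (liftSub f n)) = liftSub fun n => tr (f n) := by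
  funext n
  cases n with
  | zero => rfl
  | succ n => exact tr_rename _ _

theorem tr_subst (M : Tm) (f : ℕ → Tm) : tr (subst f M) = subst (fun n => tr (f n)) (tr M) := by
  induction M generalizing f <;>
    simp [tr, subst, subst_sel₁, subst_sel₂, liftSub_zero, tr_liftSub, liftSub_shift, *]

/-- A term that acts on arguments as `M` does. -/
def tag (M : Tm) : Tm := lam (srt Srt.kind) (app (shift 1 M) (var 0))

end Tm

theorem Conv.beta (U b a : Tm) : Conv (Tm.app (Tm.lam U b) a) (Tm.inst a b) :=
  .of_step (.beta U b a)

theorem conv_app_tag (M a : Tm) : Conv (app (tag M) a) (app M a) := by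
  have := Conv.beta (srt Srt.kind) (app (shift 1 M) (var 0)) a
  rwa [inst, subst, subst_scons_shift, subst_var] at this

theorem conv_app_pair (a b s : Tm) :
    Conv (app (lam star (app (app (var 0) (shift 1 a)) (shift 1 b))) s) (app (app s a) b) := by
  have := Conv.beta star (app (app (var 0) (shift 1 a)) (shift 1 b)) s
  simpa only [inst, subst, subst_scons_shift, subst_var, scons] using this

theorem conv_sel₁ (a b : Tm) : Conv (app (app sel₁ a) b) a := by
  have h := Conv.beta star (lam star (var 1)) a
  have h' := Conv.beta star (shift 1 a) b
  rw [inst_shift] at h'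
  exact (Conv.app h .rfl').trans' h'

theorem conv_sel₂ (a b : Tm) : Conv (app (app sel₂ a) b) b :=
  (Conv.app (Conv.beta star (lam star (var 0)) a) .rfl').trans' (Conv.beta star (var 0) b)

theorem conv_fst_pair (a b : Tm) : Conv (app (tr (pair a b)) sel₁) (tr a) :=
  (conv_app_pair _ _ _).trans' (conv_sel₁ _ _)

theorem conv_snd_pair (a b : Tm) : Conv (app (tr (pair a b)) sel₂) (tr b) :=
  (conv_app_pair _ _ _).trans' (conv_sel₂ _ _)

/-- Steps inside types, annotations and the last two arguments of `J` are erased. The `J`-rule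
itself becomes an identity, since `J c a b q` is realized by `c` applied to `a`, and the projection
rules become β-steps on the encoded pairs. -/
theorem Step.tr {M N : Tm} (h : Step M N) : Conv (Tm.tr M) (Tm.tr N) := by
  induction h with
  | beta U b a =>
    have := Conv.beta star (Tm.tr b) (Tm.tr a)
    have e : Tm.tr (inst a b) = inst (Tm.tr a) (Tm.tr b) := by
      rw [inst, tr_subst]
      congr 1; funext n; cases n <;> rfl
    rw [e]
    exact this
  | J_refl c a => exact .rfl'
  | fst_pair a b => exact conv_fst_pair a b
  | snd_pair a b => exact conv_snd_pair a b
  | pi_left | pi_right | idt_type | idt_left | idt_right | sig_left | sig_right | lam_left | J_3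
  | J_4 => exact .rfl'
  | lam_right _ _ ih => exact .lam .rfl' ih
  | app_left _ _ ih => exact .app ih .rfl'
  | app_right _ _ ih => exact .app .rfl' ih
  | J_1 _ _ _ _ ih => exact .app ih .rfl'
  | J_2 _ _ _ _ ih => exact .app .rfl' ih
  | pair_left _ _ ih => exact .lam .rfl' (.app (.app .rfl' (ih.shift 1)) .rfl')
  | pair_right _ _ ih => exact .lam .rfl' (.app .rfl' (ih.shift 1))
  | fst_congr _ ih => exact .app ih .rfl'
  | snd_congr _ ih => exact .app ih .rfl'

theorem Conv.tr {M N : Tm} (h : Conv M N) : Conv (Tm.tr M) (Tm.tr N) :=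
  Conv.map (fun _ _ => Step.tr) h

/-! ### The realizability model. -/

/-- The sets of realizers that interpret types. -/
structure PolySet (X : Set Tm) : Prop where
  sat : ∀ {a b : Tm}, Conv a b → a ∈ X → b ∈ X
  tag_or_refl : (∀ a ∈ X, tag a ∈ X) ∨ ∀ a ∈ X, Conv a refl

/-- The interpretations of constructors: families of polymorphic sets indexed by arguments. -/
structure PolyFun (F : List Tm → Set Tm) : Prop where
  congr : ∀ {l l' : List Tm}, List.Forall₂ Conv l l' → F l = F l'
  poly : ∀ l, PolySet (F l)

theorem PolySet.univ : PolySet Set.univ := ⟨fun _ _ => trivial, .inl fun _ _ => trivial⟩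

theorem PolyFun.univ : PolyFun fun _ => Set.univ := ⟨fun _ => rfl, fun _ => .univ⟩

theorem PolyFun.ncons {X : List Tm → Set Tm} {η : ℕ → List Tm → Set Tm} (hX : PolyFun X)
    (hη : ∀ n, PolyFun (η n)) (n : ℕ) : PolyFun (ncons X η n) := by
  cases n with
  | zero => exact hX
  | succ n => exact hη n

/-- The interpretation of types and constructors, for the realizers `ρ` of the variables, the
interpretations `η` of the constructor variables, and a list of arguments. -/
def sem : Tm → (ℕ → Tm) → (ℕ → List Tm → Set Tm) → List Tm → Set Tm
  | var n, _, η, l => η n l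
  | pi U T, ρ, η, _ =>
    {f | ∀ a ∈ sem U ρ η [], ∀ X, PolyFun X → app f a ∈ sem T (scons a ρ) (ncons X η) []}
  | lam _ _, _, _, [] => Set.univ
  | lam _ b, ρ, η, a :: l => sem b (scons a ρ) (ncons (fun _ => Set.univ) η) l
  | app F a, ρ, η, l => sem F ρ η (subst ρ (tr a) :: l)
  | idt _ a b, ρ, _, _ => {q | Conv q refl ∧ Conv (subst ρ (tr a)) (subst ρ (tr b))}
  | sig σ τ, ρ, η, _ =>
    {p | app p sel₁ ∈ sem σ ρ η [] ∧
      app p sel₂ ∈ sem τ (scons (app p sel₁) ρ) (ncons (fun _ => Set.univ) η) []}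
  | _, _, _, _ => Set.univ

theorem Conv.scons {a a' : Tm} {f g : ℕ → Tm} (ha : Conv a a') (h : ∀ n, Conv (f n) (g n))
    (n : ℕ) : Conv (Tm.scons a f n) (Tm.scons a' g n) := by
  cases n with
  | zero => exact ha
  | succ n => exact h n

theorem sem_congr (M : Tm) {ρ ρ' : ℕ → Tm} {η : ℕ → List Tm → Set Tm} {l l' : List Tm}
    (hρ : ∀ n, Conv (ρ n) (ρ' n)) (hη : ∀ n, PolyFun (η n)) (hl : List.Forall₂ Conv l l') :
    sem M ρ η l = sem M ρ' η l' := by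
  induction M generalizing ρ ρ' η l l' with
  | srt | refl | J | pair | fst | snd | uip => simp only [sem]
  | var n => exact (hη n).congr hl
  | pi U T ihU ihT =>
    simp only [sem]
    rw [ihU hρ hη .nil]
    ext f
    refine forall₂_congr fun a _ => forall₂_congr fun X hX => ?_
    rw [ihT (Conv.scons .rfl' hρ) (hX.ncons hη) .nil]
  | lam U b _ ih =>
    cases hl with
    | nil => rfl
    | cons h hl => exact ih (Conv.scons h hρ) (PolyFun.univ.ncons hη) hl
  | app F a ih _ => exact ih hρ hη (.cons (Conv.subst_congr _ hρ) hl)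
  | idt σ a b =>
    have (M : Tm) := Conv.subst_congr (tr M) hρ
    ext q
    exact and_congr_right fun _ => ⟨fun h => ((this a).symm'.trans' h).trans' (this b),
      fun h => ((this a).trans' h).trans' (this b).symm'⟩
  | sig σ τ ihσ ihτ =>
    simp only [sem]
    rw [ihσ hρ hη .nil]
    ext p
    refine and_congr_right fun _ => ?_
    rw [ihτ (Conv.scons .rfl' hρ) (PolyFun.univ.ncons hη) .nil]

/-- For products and sums, membership is tested only on applications of the term, so any term with
convertible applications belongs too; `tag` gives such a term. Encoding pairs as functions is what
brings sums under this argument. The interpretation of an identity type contains only terms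
convertible to `refl`. -/
theorem sem_polySet (M : Tm) (ρ : ℕ → Tm) {η : ℕ → List Tm → Set Tm}
    (hη : ∀ n, PolyFun (η n)) (l : List Tm) : PolySet (sem M ρ η l) := by
  induction M generalizing ρ η l with
  | srt | refl | J | pair | fst | snd | uip => exact .univ
  | var n => exact (hη n).poly l
  | pi U T _ ih =>
    have sat (f : Tm) (hf : f ∈ sem (pi U T) ρ η l) (g : Tm)
        (h : ∀ a, Conv (app f a) (app g a)) : g ∈ sem (pi U T) ρ η l :=
      fun a ha X hX => (ih _ (hX.ncons hη) _).sat (h a) (hf a ha X hX)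
    exact ⟨fun h hf => sat _ hf _ fun _ => .app h .rfl',
      .inl fun f hf => sat _ hf _ fun a => (conv_app_tag f a).symm'⟩
  | lam U b _ ih =>
    cases l with
    | nil => exact .univ
    | cons a l => exact ih _ (PolyFun.univ.ncons hη) l
  | app F a ih _ => exact ih _ hη _
  | idt σ a b => exact ⟨fun h hq => ⟨h.symm'.trans' hq.1, hq.2⟩, .inr fun _ h => h.1⟩
  | sig σ τ ihσ ihτ =>
    have sat (f : Tm) (hf : f ∈ sem (sig σ τ) ρ η l) (g : Tm)
        (h : ∀ a, Conv (app f a) (app g a)) : g ∈ sem (sig σ τ) ρ η l := by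
      refine ⟨(ihσ _ hη _).sat (h _) hf.1, (ihτ _ (PolyFun.univ.ncons hη) _).sat (h _) ?_⟩
      rw [← sem_congr τ (Conv.scons (h _) fun _ => .rfl') (PolyFun.univ.ncons hη) .nil]
      exact hf.2
    exact ⟨fun h hf => sat _ hf _ fun _ => .app h .rfl',
      .inl fun f hf => sat _ hf _ fun a => (conv_app_tag f a).symm'⟩

theorem sem_polyFun (M : Tm) (ρ : ℕ → Tm) {η : ℕ → List Tm → Set Tm}
    (hη : ∀ n, PolyFun (η n)) : PolyFun (sem M ρ η) :=
  ⟨sem_congr M (fun _ => .rfl') hη, sem_polySet M ρ hη⟩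

theorem sem_rename (M : Tm) (r : ℕ → ℕ) (ρ : ℕ → Tm) (η : ℕ → List Tm → Set Tm) (l : List Tm) :
    sem (rename r M) ρ η l = sem M (fun n => ρ (r n)) (fun n => η (r n)) l := by
  have hs (r : ℕ → ℕ) (ρ : ℕ → Tm) (a : Tm) :
      (fun n => scons a ρ (liftRen r n)) = scons a fun n => ρ (r n) := by
    funext n; cases n <;> rfl
  have hn (r : ℕ → ℕ) (η : ℕ → List Tm → Set Tm) (X) :
      (fun n => ncons X η (liftRen r n)) = ncons X fun n => η (r n) := by
    funext n; cases n <;> rfl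
  induction M generalizing r ρ η l with
  | lam U b _ ih =>
    cases l with
    | nil => rfl
    | cons a l => simp only [rename, sem, ih, hs, hn]
  | _ => simp only [rename, sem, tr_rename, subst_rename, *]

theorem sem_shift (M : Tm) (ρ : ℕ → Tm) (η : ℕ → List Tm → Set Tm) (l : List Tm) :
    sem (shift 1 M) ρ η l = sem M (fun n => ρ (n + 1)) (fun n => η (n + 1)) l :=
  sem_rename M _ ρ η l

/-- A substituted term enters the environment twice: through its realizer and through its
interpretation as a constructor. -/
theorem sem_subst (M : Tm) (f : ℕ → Tm) (ρ : ℕ → Tm) (η : ℕ → List Tm → Set Tm) (l : List Tm) :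
    sem (subst f M) ρ η l =
      sem M (fun n => subst ρ (tr (f n))) (fun n => sem (f n) ρ η) l := by
  have hs (f ρ : ℕ → Tm) (a : Tm) :
      (fun n => subst (scons a ρ) (tr (liftSub f n))) =
        scons a fun n => subst ρ (tr (f n)) := by
    funext n
    cases n with
    | zero => rfl
    | succ n =>
      simp only [liftSub, shift, tr_rename, subst_rename]
      rfl
  have hn (f ρ : ℕ → Tm) (η : ℕ → List Tm → Set Tm) (a : Tm) (X) :
      (fun n => sem (liftSub f n) (scons a ρ) (ncons X η)) =
        ncons X fun n => sem (f n) ρ η := by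
    funext n l
    cases n with
    | zero => rfl
    | succ n => exact sem_shift _ _ _ _
  induction M generalizing f ρ η l with
  | lam U b _ ih =>
    cases l with
    | nil => rfl
    | cons a l => simp only [subst, sem, ih, hs, hn]
  | _ => simp only [subst, sem, tr_subst, subst_subst, *]

theorem sem_inst (M a : Tm) (ρ : ℕ → Tm) (η : ℕ → List Tm → Set Tm) (l : List Tm) :
    sem (inst a M) ρ η l = sem M (scons (subst ρ (tr a)) ρ) (ncons (sem a ρ η) η) l := by
  rw [inst, sem_subst]
  congr 1
  · funext n; cases n <;> rfl
  · funext n l; cases n <;> rfl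

/-- The interpretation does not depend on the constructor part of object variables. -/
theorem Cs.sem_congr {Δ : ℕ → Option ℕ} {c : Cls} {M : Tm} (h : Cs Δ c M) {ρ : ℕ → Tm}
    {η η' : ℕ → List Tm → Set Tm} {l : List Tm} (hη : ∀ n k, Δ n = some k → η n = η' n) :
    sem M ρ η l = sem M ρ η' l := by
  have lift : ∀ {Δ : ℕ → Option ℕ} {η η' : ℕ → List Tm → Set Tm} (d : Option ℕ) X,
      (∀ n k, Δ n = some k → η n = η' n) →
      ∀ n k, ncons d Δ n = some k → ncons X η n = ncons X η' n := by
    intro Δ η η' d X h n k hn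
    cases n with
    | zero => rfl
    | succ n => exact h n k hn
  induction h generalizing ρ η η' l with
  | star => rfl
  | var h => exact congrFun (hη _ _ h) l
  | piObj _ _ ih ih' | piKnd _ _ ih ih' | kndPi _ _ ih ih' =>
    simp only [sem]
    rw [ih hη]
    ext f
    refine forall₂_congr fun a _ => forall₂_congr fun X hX => ?_
    rw [ih' (lift _ X hη)]
  | lam _ ih =>
    cases l with
    | nil => rfl
    | cons a l => exact ih (lift _ _ hη)
  | app _ ih => exact ih hη
  | idt => rfl
  | sig _ _ ih ih' =>
    simp only [sem]
    rw [ih hη]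
    ext p
    rw [Set.mem_ofPred_eq, Set.mem_ofPred_eq, ih' (lift _ _ hη)]

theorem Cs.sem_ncons {Δ : ℕ → Option ℕ} {c : Cls} {M : Tm} (h : Cs (ncons none Δ) c M)
    (ρ : ℕ → Tm) (η : ℕ → List Tm → Set Tm) (l : List Tm) (X Y : List Tm → Set Tm) :
    sem M ρ (ncons X η) l = sem M ρ (ncons Y η) l :=
  h.sem_congr fun n k hn => by
    cases n with
    | zero => cases hn
    | succ n => rfl

/-- Classified terms are inert or compute by β on object arguments, and those arguments matter only
through their realizers, which erasure keeps convertible. -/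
theorem Cs.sem_par {Δ : ℕ → Option ℕ} {c : Cls} {M N : Tm} (h : Cs Δ c M) (hp : Par M N)
    {ρ : ℕ → Tm} {η : ℕ → List Tm → Set Tm} {l : List Tm} (hη : ∀ n, PolyFun (η n)) :
    sem M ρ η l = sem N ρ η l := by
  induction h generalizing N ρ η l with
  | star => cases hp; rfl
  | var _ => cases hp; rfl
  | piObj _ _ ih ih' | piKnd _ _ ih ih' | kndPi _ _ ih ih' =>
    cases hp with
    | pi p q =>
      simp only [sem]
      rw [ih p hη]
      ext f
      refine forall₂_congr fun a _ => forall₂_congr fun X hX => ?_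
      rw [ih' q (hX.ncons hη)]
  | lam _ ih =>
    cases hp with
    | lam _ p =>
      cases l with
      | nil => rfl
      | cons a l => exact ih p (PolyFun.univ.ncons hη)
  | @app Δ n F a h ih =>
    have key {F' a' : Tm} (p : Par F F') (q : Par a a') :
        sem (Tm.app F a) ρ η l = sem F' ρ η (Tm.subst ρ (Tm.tr a') :: l) :=
      (ih p hη).trans (LP2.sem_congr F' (fun _ => .rfl') hη
        (.cons (q.conv.tr.subst ρ) (List.forall₂_same.2 fun _ _ => .rfl')))
    cases hp with
    | app p q => exact key p q
    | beta U p q =>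
      -- The abstraction gives its variable the family `Set.univ`, whereas `sem_inst` gives it the
      -- interpretation of the argument. The difference is invisible because the bound variable is
      -- an object variable.
      have p' := Par.lam (.rfl' U) p
      rw [key p' q, sem_inst]
      cases h.par p' with
      | lam k => exact k.sem_ncons _ _ _ _ _
  | idt _ _ =>
    cases hp with
    | idt _ p q =>
      have p := p.conv.tr.subst ρ
      have q := q.conv.tr.subst ρ
      ext x
      exact and_congr_right fun _ => ⟨fun h => (p.symm'.trans' h).trans' q,
        fun h => (p.trans' h).trans' q.symm'⟩
  | sig _ _ ih ih' =>
    cases hp with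
    | sig p q =>
      simp only [sem]
      rw [ih p hη]
      ext x
      rw [Set.mem_ofPred_eq, Set.mem_ofPred_eq, ih' q (PolyFun.univ.ncons hη)]

theorem Cs.sem_pars {Δ : ℕ → Option ℕ} {c : Cls} {M N : Tm} (h : Cs Δ c M) (hp : Pars M N)
    {ρ : ℕ → Tm} {η : ℕ → List Tm → Set Tm} {l : List Tm} (hη : ∀ n, PolyFun (η n)) :
    sem M ρ η l = sem N ρ η l := by
  induction hp with
  | refl => rfl
  | tail hp p ih => exact ih.trans ((h.pars hp).sem_par p hη)

theorem Cs.sem_conv {Δ : ℕ → Option ℕ} {c c' : Cls} {M N : Tm} (h : Cs Δ c M) (h' : Cs Δ c' N)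
    (hc : Conv M N) {ρ : ℕ → Tm} {η : ℕ → List Tm → Set Tm} {l : List Tm}
    (hη : ∀ n, PolyFun (η n)) : sem M ρ η l = sem N ρ η l :=
  let ⟨_, p, q⟩ := hc.join
  (h.sem_pars p hη).trans (h'.sem_pars q hη).symm

/-! ### Soundness of the model. -/

/-- Environments that realize a context. -/
def Sat : List Tm → (ℕ → Tm) → (ℕ → List Tm → Set Tm) → Prop
  | [], _, _ => True
  | T :: Γ, ρ, η => ρ 0 ∈ sem T (fun n => ρ (n + 1)) (fun n => η (n + 1)) [] ∧
      Sat Γ (fun n => ρ (n + 1)) fun n => η (n + 1)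

/-- Semantic core of `J`: a realized identity makes the endpoints convertible and the proof
convertible to `refl`, so the two environments agree up to conversion. Their constructor components
at the three object variables are irrelevant. -/
theorem sem_idt_diag {Δ : ℕ → Option ℕ} {τ a b q : Tm} {ρ : ℕ → Tm}
    {η : ℕ → List Tm → Set Tm} {X : List Tm → Set Tm}
    (h : Cs (ncons none (ncons none (ncons none Δ))) (.con 0) τ) (hη : ∀ n, PolyFun (η n))
    (hq : Conv (subst ρ (tr q)) refl) (hab : Conv (subst ρ (tr a)) (subst ρ (tr b))) :
    sem (instDiag τ) (scons (subst ρ (tr a)) ρ) (ncons X η) [] = sem (inst3 a b q τ) ρ η [] := by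
  rw [instDiag, inst3, sem_subst, sem_subst]
  rw [h.sem_congr (η' := fun n => sem (scons q (scons b (scons a var)) n) ρ η)]
  · refine sem_congr _ (fun n => ?_) (fun n => sem_polyFun _ _ hη) .nil
    rcases n with _ | _ | _ | n
    · exact hq.symm'
    · exact hab
    · exact .rfl'
    · exact .rfl'
  · intro n k hn
    rcases n with _ | _ | _ | n
    · cases hn
    · cases hn
    · cases hn
    · rfl

/-- Typed terms are realized. -/
theorem Typed.sound {Γ : List Tm} {M T : Tm} (h : Typed Γ M T) {ρ : ℕ → Tm}
    {η : ℕ → List Tm → Set Tm} (hη : ∀ n, PolyFun (η n)) (hρ : Sat Γ ρ η) :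
    subst ρ (tr M) ∈ sem T ρ η [] := by
  induction h generalizing ρ η with
  | ax => trivial
  | var _ _ => rw [sem_shift]; exact hρ.1
  | weak _ _ ih _ =>
    have := ih (fun n => hη (n + 1)) hρ.2
    rwa [sem_shift, shift, tr_rename, subst_rename]
  | conv hM hU hc ih _ =>
    obtain ⟨Δ, hΔ, h⟩ := hM.hasCls
    obtain ⟨Δ', hΔ', h'⟩ := hU.hasCls
    cases hΔ.unique hΔ'
    obtain ⟨c, hc'⟩ := h'.srt_inv
    cases h with
    | kind _ => exact absurd hc hc'.not_conv_kind
    | con h _ => rw [← h.sem_conv hc' hc hη]; exact ih hη hρ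
    | obj h => rw [← h.sem_conv hc' hc hη]; exact ih hη hρ
  | pi | idt | sig => simp only [sem]; trivial
  | @lam Γ U T b s _ _ _ ih =>
    intro a ha X hX
    refine (sem_polySet T _ (hX.ncons hη) _).sat ?_ (ih (hX.ncons hη) ⟨ha, hρ⟩)
    have := Conv.beta star (subst (liftSub ρ) (tr b)) a
    rw [inst_subst_liftSub] at this
    exact this.symm'
  | app _ _ ih ih' =>
    rw [sem_inst]
    exact ih hη hρ _ (ih' hη hρ) _ (sem_polyFun _ _ hη)
  | refl => exact ⟨.rfl', .rfl'⟩
  | J ha hb hq hτ hc iha _ ihq _ ihc =>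
    obtain ⟨hq₁, hq₂⟩ := ihq hη hρ
    obtain ⟨Δ, hΔ, h⟩ := hq.hasCls
    obtain ⟨Δ', hΔ', h'⟩ := hτ.hasCls
    cases h with
    | con h _ => cases h
    | obj h =>
      cases h with
      | idt h =>
        cases hΔ'.unique (((hΔ.obj h).obj (h.shift none)).obj
          (.idt (by simpa [Tm.shift, rename_rename] using (h.shift none).shift none)))
        rw [← sem_idt_diag h'.star_inv hη hq₁ hq₂]
        exact ihc hη hρ _ (iha hη hρ) _ PolyFun.univ
  | @pair Γ σ τ a b hs _ _ _ iha ihb =>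
    obtain ⟨Δ, hΔ, h⟩ := hs.hasCls
    cases h.star_inv with
    | sig _ hτ =>
      have h₁ := (conv_fst_pair a b).subst ρ
      have h₂ := (conv_snd_pair a b).subst ρ
      refine ⟨(sem_polySet σ _ hη _).sat h₁.symm' (iha hη hρ),
        (sem_polySet τ _ (PolyFun.univ.ncons hη) _).sat h₂.symm' ?_⟩
      have := ihb hη hρ
      rw [sem_inst, hτ.sem_ncons _ _ _ _ fun _ => Set.univ] at this
      rwa [← sem_congr τ (Conv.scons h₁ fun _ => .rfl') (PolyFun.univ.ncons hη) .nil] at this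
  | fst _ ih => exact (ih hη hρ).1
  | snd hp ih =>
    obtain ⟨Δ, hΔ, h⟩ := hp.hasCls
    cases h with
    | con h _ => cases h
    | obj h =>
      cases h with
      | sig _ hτ =>
        rw [sem_inst, hτ.sem_ncons _ _ _ _ fun _ => Set.univ]
        exact (ih hη hρ).2
  | uip =>
    -- Both proofs are convertible to `refl`, hence to each other, and the realizer of `uip` reaches
    -- `refl` after five β-steps.
    intro α _ X hX x _ _ _ y _ _ _ p hp _ _ q hq _ _
    have step {b : Tm} (a : Tm) (h : inst a b = b) : Conv (Tm.app (Tm.lam star b) a) b := by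
      simpa only [h] using Conv.beta star b a
    have red := ((((((((step α rfl).app .rfl').trans' (step x rfl)).app .rfl').trans'
      (step y rfl)).app .rfl').trans' (step p rfl)).app .rfl').trans' (step (b := Tm.refl) q rfl)
    exact ⟨red, hp.1.trans' hq.1.symm'⟩

theorem Tm.shift_subst (M : Tm) (f : ℕ → Tm) (k : ℕ) :
    shift k (subst f M) = subst (fun n => shift k (f n)) M :=
  rename_subst M f _

/-- `PolySet` leaves open which alternative holds; the syntactic dichotomy needs the first one
outright for products. -/
theorem sem_pi_tag (U T : Tm) (ρ : ℕ → Tm) {η : ℕ → List Tm → Set Tm} (hη : ∀ n, PolyFun (η n))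
    {l : List Tm} {f : Tm} (hf : f ∈ sem (pi U T) ρ η l) : tag f ∈ sem (pi U T) ρ η l :=
  fun a ha X hX => (sem_polySet T _ (hX.ncons hη) _).sat (conv_app_tag f a).symm' (hf a ha X hX)

theorem sem_sig_tag (σ τ : Tm) (ρ : ℕ → Tm) {η : ℕ → List Tm → Set Tm} (hη : ∀ n, PolyFun (η n))
    {l : List Tm} {p : Tm} (hp : p ∈ sem (sig σ τ) ρ η l) : tag p ∈ sem (sig σ τ) ρ η l := by
  refine ⟨(sem_polySet σ _ hη _).sat (conv_app_tag p _).symm' hp.1,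
    (sem_polySet τ _ (PolyFun.univ.ncons hη) _).sat (conv_app_tag p _).symm' ?_⟩
  rw [sem_congr τ (Conv.scons (conv_app_tag p _) fun _ => .rfl') (PolyFun.univ.ncons hη) .nil]
  exact hp.2

/-! ### Stability of typing under substitution. -/

/-- Well-formed contexts. -/
inductive Wf : List Tm → Prop
  | nil : Wf []
  | cons {Γ T s} : Wf Γ → Typed Γ T (srt s) → Wf (T :: Γ)

/-- `SubOK Γ Δ f`: the substitution `f` assigns terms in context `Γ` to the variables of `Δ`. -/
def SubOK (Γ : List Tm) : List Tm → (ℕ → Tm) → Prop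
  | [], _ => True
  | T :: Δ, f => Typed Γ (f 0) (subst (fun n => f (n + 1)) T) ∧ SubOK Γ Δ fun n => f (n + 1)

theorem Wf.star {Γ : List Tm} (h : Wf Γ) : Typed Γ star (srt .kind) := by
  induction h with
  | nil => exact .ax
  | cons _ hT ih => exact .weak ih hT

theorem Wf.uip {Γ : List Tm} (h : Wf Γ) : Typed Γ uip UIPType := by
  induction h with
  | nil => exact .uip
  | cons _ hT ih => exact .weak ih hT

theorem SubOK.shift {Γ Δ : List Tm} {f : ℕ → Tm} {U : Tm} {s : Srt} (h : SubOK Γ Δ f)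
    (hU : Typed Γ U (srt s)) : SubOK (U :: Γ) Δ fun n => shift 1 (f n) := by
  induction Δ generalizing f with
  | nil => trivial
  | cons T Δ ih =>
    refine ⟨?_, ih h.2⟩
    have := Typed.weak h.1 hU
    rw [shift_subst] at this
    exact this

theorem SubOK.lift {Γ Δ : List Tm} {f : ℕ → Tm} {T : Tm} {s : Srt} (h : SubOK Γ Δ f)
    (hT : Typed Γ (subst f T) (srt s)) : SubOK (subst f T :: Γ) (T :: Δ) (liftSub f) := by
  refine ⟨?_, h.shift hT⟩
  have := Typed.var hT
  rwa [Tm.shift, rename_subst] at this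

namespace Tm

theorem subst_inst3 (a b q τ : Tm) (f : ℕ → Tm) :
    subst f (inst3 a b q τ) =
      inst3 (subst f a) (subst f b) (subst f q) (subst (liftSub (liftSub (liftSub f))) τ) := by
  rw [inst3, inst3, subst_subst, subst_subst]
  congr 1
  funext n
  rcases n with _ | _ | _ | n
  · rfl
  · rfl
  · rfl
  · simp only [liftSub, scons, subst, subst_scons_shift, subst_var]

theorem subst_instDiag (τ : Tm) (f : ℕ → Tm) :
    subst (liftSub f) (instDiag τ) = instDiag (subst (liftSub (liftSub (liftSub f))) τ) := by
  rw [instDiag, instDiag, subst_subst, subst_subst]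
  congr 1
  funext n
  rcases n with _ | _ | _ | n
  · rfl
  · rfl
  · rfl
  · simp only [liftSub, scons, subst, subst_scons_shift, ← rename_eq_subst]
    rfl

theorem liftSub_liftSub_shift (σ : Tm) (f : ℕ → Tm) :
    subst (liftSub (liftSub f)) (shift 2 σ) = shift 2 (subst f σ) := by
  simp [shift, subst_rename, rename_subst, liftSub, rename_rename]

end Tm

/-- `T` is a type after every well-typed substitution for `Γ`. -/
def SubstTyped (Γ : List Tm) (T : Tm) : Prop :=
  ∃ s, ∀ Δ f, Wf Δ → SubOK Δ Γ f → Typed Δ (subst f T) (srt s)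

/-- Contexts of types in the sense of `SubstTyped`. -/
inductive WfSubst : List Tm → Prop
  | nil : WfSubst []
  | cons {Γ T} : WfSubst Γ → SubstTyped Γ T → WfSubst (T :: Γ)

/-- Going under a binder requires the substituted domain to be a type, but the rules for `lam` and
`J` have no premise from which this is immediate. The induction therefore also carries the fact that
every context entry stays a type under substitution. -/
theorem Typed.subst_aux {Γ : List Tm} {M T : Tm} (h : Typed Γ M T) :
    WfSubst Γ ∧ ∀ Δ f, Wf Δ → SubOK Δ Γ f → Typed Δ (Tm.subst f M) (Tm.subst f T) := by
  induction h with
  | ax => exact ⟨.nil, fun Δ f hΔ _ => hΔ.star⟩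
  | var _ ih =>
    refine ⟨.cons ih.1 ⟨_, ih.2⟩, fun Δ f hΔ hf => ?_⟩
    rw [subst_shift]
    exact hf.1
  | weak _ _ ih ih' =>
    refine ⟨.cons ih.1 ⟨_, ih'.2⟩, fun Δ f hΔ hf => ?_⟩
    rw [subst_shift, subst_shift]
    exact ih.2 _ _ hΔ hf.2
  | conv _ _ hc ih ih' =>
    exact ⟨ih.1, fun Δ f hΔ hf => .conv (ih.2 Δ f hΔ hf) (ih'.2 Δ f hΔ hf) (hc.subst f)⟩
  | pi hs _ _ ih ih' =>
    exact ⟨ih.1, fun Δ f hΔ hf => .pi hs (ih.2 Δ f hΔ hf)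
      (ih'.2 _ _ (.cons hΔ (ih.2 Δ f hΔ hf)) (hf.lift (ih.2 Δ f hΔ hf)))⟩
  | lam _ _ ih ih' =>
    refine ⟨ih.1, fun Δ f hΔ hf => .lam (ih.2 Δ f hΔ hf) ?_⟩
    cases ih'.1 with
    | cons _ hU =>
      obtain ⟨s, hU⟩ := hU
      exact ih'.2 _ _ (.cons hΔ (hU Δ f hΔ hf)) (hf.lift (hU Δ f hΔ hf))
  | app _ _ ih ih' =>
    refine ⟨ih.1, fun Δ f hΔ hf => ?_⟩
    rw [subst_inst]
    exact .app (ih.2 Δ f hΔ hf) (ih'.2 Δ f hΔ hf)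
  | idt _ _ _ ih ih' ih'' =>
    exact ⟨ih.1, fun Δ f hΔ hf => .idt (ih.2 Δ f hΔ hf) (ih'.2 Δ f hΔ hf) (ih''.2 Δ f hΔ hf)⟩
  | refl _ _ ih ih' =>
    exact ⟨ih.1, fun Δ f hΔ hf => .refl (ih.2 Δ f hΔ hf) (ih'.2 Δ f hΔ hf)⟩
  | @J Γ σ τ a b c q _ _ _ _ _ iha ihb ihq ihτ ihc =>
    refine ⟨iha.1, fun Δ f hΔ hf => ?_⟩
    rw [subst_inst3]
    refine .J (iha.2 Δ f hΔ hf) (ihb.2 Δ f hΔ hf) (ihq.2 Δ f hΔ hf) ?_ ?_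
    · cases ihτ.1 with
      | cons h₂ hi =>
        cases h₂ with
        | cons h₁ hσ' =>
          cases h₁ with
          | cons h₀ hσ =>
            obtain ⟨_, hσ⟩ := hσ
            obtain ⟨_, hσ'⟩ := hσ'
            obtain ⟨_, hi⟩ := hi
            have w₁ := hσ Δ f hΔ hf
            have f₁ := hf.lift w₁
            have hΔ₁ := hΔ.cons w₁
            have w₂ := hσ' _ _ hΔ₁ f₁
            have f₂ := f₁.lift w₂
            have hΔ₂ := hΔ₁.cons w₂
            have w₃ := hi _ _ hΔ₂ f₂
            have := ihτ.2 _ _ (hΔ₂.cons w₃) (f₂.lift w₃)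
            simp only [liftSub_shift, Tm.subst, liftSub_liftSub_shift] at this
            exact this
    · rw [← subst_instDiag]
      exact ihc.2 Δ f hΔ hf
  | sig _ _ ih ih' =>
    exact ⟨ih.1, fun Δ f hΔ hf => .sig (ih.2 Δ f hΔ hf)
      (ih'.2 _ _ (.cons hΔ (ih.2 Δ f hΔ hf)) (hf.lift (ih.2 Δ f hΔ hf)))⟩
  | pair _ _ _ ih iha ihb =>
    refine ⟨ih.1, fun Δ f hΔ hf => .pair (ih.2 Δ f hΔ hf) (iha.2 Δ f hΔ hf) ?_⟩
    rw [← subst_inst]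
    exact ihb.2 Δ f hΔ hf
  | fst _ ih => exact ⟨ih.1, fun Δ f hΔ hf => .fst (ih.2 Δ f hΔ hf)⟩
  | snd _ ih =>
    refine ⟨ih.1, fun Δ f hΔ hf => ?_⟩
    rw [subst_inst]
    exact .snd (ih.2 Δ f hΔ hf)
  | uip => exact ⟨.nil, fun Δ f hΔ _ => hΔ.uip⟩

theorem Typed.subst {Γ Δ : List Tm} {M T : Tm} {f : ℕ → Tm} (h : Typed Γ M T) (hΔ : Wf Δ)
    (hf : SubOK Δ Γ f) : Typed Δ (Tm.subst f M) (Tm.subst f T) :=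
  h.subst_aux.2 Δ f hΔ hf

theorem Typed.inst_closed {U a M T : Tm} (h : Typed [U] M T) (ha : Typed [] a U) :
    Typed [] (Tm.inst a M) (Tm.inst a T) :=
  h.subst .nil ⟨by rwa [show (fun n => scons a Tm.var (n + 1)) = Tm.var from rfl, subst_var], trivial⟩

theorem Typed.pi_inv {U T X : Tm} (h : Typed [] (Tm.pi U T) X) :
    ∃ s s', Typed [] U (srt s) ∧ Typed [U] T (srt s') := by
  generalize hΓ : [] = Γ at h
  generalize hM : Tm.pi U T = M at h
  induction h with
  | conv _ _ _ ih _ => exact ih hΓ hM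
  | pi _ h h' _ _ => cases hM; cases hΓ; exact ⟨_, _, h, h'⟩
  | var | weak => cases hΓ
  | _ => cases hM

/-! ### The derivability dichotomy for closed types. -/

theorem Typed.app_subst {Γ : List Tm} {g a U T : Tm} {f : ℕ → Tm}
    (h : Typed Γ g (Tm.subst f (Tm.pi U T))) (ha : Typed Γ a (Tm.subst f U)) :
    Typed Γ (Tm.app g a) (Tm.subst (scons a f) T) := by
  rw [← inst_subst_liftSub]
  exact .app h ha

theorem derivable_idt_idt {σ a b p q : Tm} (hσ : Typed [] σ star) (ha : Typed [] a σ)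
    (hb : Typed [] b σ) (hp : Typed [] p (idt σ a b)) (hq : Typed [] q (idt σ a b)) :
    Derivable (idt (idt σ a b) p q) := by
  have h₀ : Typed [] uip (subst var UIPType) := .uip
  have h₁ := h₀.app_subst (a := σ) hσ
  have h₂ := h₁.app_subst (a := a) ha
  have h₃ := h₂.app_subst (a := b) hb
  have h₄ := h₃.app_subst (a := p) hp
  exact ⟨_, h₄.app_subst (a := q) hq⟩

/-- The interpretation of the closed type `N` is closed under `tag`, or uniqueness is derivable
for all closed terms of type `N`. -/
def TagOrProp (N : Tm) : Prop :=
  (∀ x ∈ sem N var (fun _ _ => Set.univ) [], tag x ∈ sem N var (fun _ _ => Set.univ) []) ∨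
    ∀ a b, Typed [] a N → Typed [] b N → Derivable (idt N a b)

/-- `Red n K M`: the closed constructor `M` of the kind `K` with `n` arguments satisfies
`TagOrProp` for all closed arguments. -/
def Red : ℕ → Tm → Tm → Prop
  | 0, _, M => TagOrProp M
  | n + 1, pi U K, M => ∀ a, Typed [] a U → Red n (inst a K) (app M a)
  | _ + 1, _, _ => True

theorem Typed.cs_con {M : Tm} (h : Typed [] M star) : Cs (fun _ => none) (.con 0) M := by
  obtain ⟨Δ, hΔ, h⟩ := h.hasCls
  cases hΔ
  exact h.star_inv

/-- Invariance of the interpretation transfers the first alternative, and the conversion rule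
transfers the second. -/
theorem TagOrProp.of_conv {M M' : Tm} (h : TagOrProp M') (hc : Conv M M') (hM : Typed [] M star)
    (hM' : Typed [] M' star) : TagOrProp M := by
  rcases h with h | h
  · left
    rwa [hM.cs_con.sem_conv hM'.cs_con hc fun _ => PolyFun.univ]
  · right
    intro a b ha hb
    obtain ⟨P, hP⟩ := h a b (.conv ha hM' hc) (.conv hb hM' hc)
    exact ⟨P, .conv hP (.idt hM ha hb) (.idt hc.symm' .rfl' .rfl')⟩

theorem Red.of_conv {n : ℕ} {K M M' : Tm} {s : Srt} (h : Red n K M')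
    (hK : Cs (fun _ => none) (.knd n) K) (hK' : Typed [] K (srt s)) (hc : Conv M M')
    (hM : Typed [] M K) (hM' : Typed [] M' K) : Red n K M := by
  induction n generalizing K M M' s with
  | zero => cases hK; exact TagOrProp.of_conv h hc hM hM'
  | succ n ih =>
    cases hK with
    | kndPi _ k =>
      obtain ⟨_, s', _, h'⟩ := hK'.pi_inv
      intro a ha
      exact ih (h a ha) (k.inst_obj a) (h'.inst_closed ha) (.app hc .rfl') (.app hM ha)
        (.app hM' ha)

/-- `Red` quantifies over inhabitants of the domain, so convertible kinds must have convertible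
domains and codomains; injectivity of products gives this. -/
theorem Red.conv_knd {n : ℕ} {K K' M : Tm} {s s' : Srt} (h : Red n K M)
    (hK : Cs (fun _ => none) (.knd n) K) (hK' : Cs (fun _ => none) (.knd n) K')
    (tK : Typed [] K (srt s)) (tK' : Typed [] K' (srt s')) (hc : Conv K K') : Red n K' M := by
  induction n generalizing K K' M s s' with
  | zero => exact h
  | succ n ih =>
    cases hK with
    | kndPi _ k =>
      cases hK' with
      | kndPi _ k' =>
        obtain ⟨_, _, tU, tT⟩ := tK.pi_inv
        obtain ⟨_, _, tU', tT'⟩ := tK'.pi_inv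
        obtain ⟨c, c'⟩ := hc.pi_inj
        intro a ha
        have ha' := Typed.conv ha tU c.symm'
        exact ih (h a ha') (k.inst_obj a) (k'.inst_obj a) (tT.inst_closed ha')
          (tT'.inst_closed ha) (.inst .rfl' c')

/-- Closed substitutions that satisfy `Red` at all constructor variables. -/
def RedSub : List Tm → (ℕ → Tm) → Prop
  | [], _ => True
  | T :: Γ, f =>
    (∀ Δ k, CtxC Γ Δ → Cs Δ (.knd k) T → Red k (subst (fun n => f (n + 1)) T) (f 0)) ∧
      RedSub Γ fun n => f (n + 1)

theorem SubOK.cs {Γ : List Tm} {Δ : ℕ → Option ℕ} (hΔ : CtxC Γ Δ) {f : ℕ → Tm}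
    (hf : SubOK [] Γ f) : ∀ n k, Δ n = some k → Cs (fun _ => none) (.con k) (f n) := by
  induction hΔ generalizing f with
  | nil => exact fun _ _ => nofun
  | obj _ _ ih =>
    intro n k hn
    cases n with
    | zero => cases hn
    | succ n => exact ih hf.2 n k hn
  | knd _ hT ih =>
    intro n k hn
    cases n with
    | zero =>
      cases hn
      obtain ⟨_, h, h'⟩ := hf.1.hasCls
      cases h
      exact h'.con_of_knd (hT.subst (ih hf.2))
    | succ n => exact ih hf.2 n k hn

/-- Fundamental lemma of the computability predicate, by induction on the derivation. Only
constructors have content: products and sums land in the `tag` alternative whatever their components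
are, identity types in the other, and constructor abstraction and application follow the arguments.
The rules that form objects are excluded by the classification. Typability of the substituted kind
is carried along to permit conversion and instantiation. -/
theorem Typed.red {Γ : List Tm} {M T : Tm} (h : Typed Γ M T) {Δ : ℕ → Option ℕ} {n : ℕ}
    (hΔ : CtxC Γ Δ) (hT : Cs Δ (.knd n) T) {f : ℕ → Tm} (hf : SubOK [] Γ f) (hr : RedSub Γ f) :
    (∃ s, Typed [] (Tm.subst f T) (srt s)) ∧ Red n (Tm.subst f T) (Tm.subst f M) := by
  have not_con {Γ : List Tm} {M T : Tm} {Δ : ℕ → Option ℕ} {n : ℕ} (h : Typed Γ M T)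
      (hΔ : CtxC Γ Δ) (hT : Cs Δ (.knd n) T) : Cs Δ (.con n) M := by
    obtain ⟨_, h', h⟩ := h.hasCls
    cases hΔ.unique h'
    exact h.con_of_knd hT
  induction h generalizing Δ n f with
  | ax => cases hT
  | var h _ =>
    rw [subst_shift]
    refine ⟨⟨_, h.subst .nil hf.2⟩, ?_⟩
    cases hΔ with
    | obj _ k => cases (k.shift _).unique hT
    | knd hΔ k => cases (k.shift _).unique hT; exact hr.1 _ _ hΔ k
  | weak h _ ih _ =>
    rw [subst_shift, subst_shift]
    obtain ⟨Δ', hΔ', h'⟩ := h.hasCls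
    have hd : ∃ d, Δ = ncons d Δ' := by
      cases hΔ with
      | obj hΔ _ => cases hΔ.unique hΔ'; exact ⟨_, rfl⟩
      | knd hΔ _ => cases hΔ.unique hΔ'; exact ⟨_, rfl⟩
    obtain ⟨d, rfl⟩ := hd
    cases h' with
    | kind _ => cases hT
    | con k _ => cases (k.shift d).unique hT; exact ih hΔ' k hf.2 hr.2
    | obj k => cases (k.shift d).unique hT
  | conv h hU hc ih _ =>
    have tU := hU.subst .nil hf
    refine ⟨⟨_, tU⟩, ?_⟩
    obtain ⟨Δ', hΔ', h'⟩ := h.hasCls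
    cases hΔ.unique hΔ'
    cases h' with
    | kind _ => exact absurd hc hT.not_conv_kind
    | con k _ =>
      cases k.eq_of_conv hT hc
      obtain ⟨⟨_, tT⟩, hM⟩ := ih hΔ k hf hr
      exact hM.conv_knd (k.subst (hf.cs hΔ)) (hT.subst (hf.cs hΔ)) tT tU (hc.subst f)
    | obj k => cases k.eq_of_conv hT hc
  | pi _ _ _ _ _ =>
    cases hT
    exact ⟨⟨_, .ax⟩, .inl fun x hx => sem_pi_tag _ _ _ (fun _ => .univ) hx⟩
  | sig _ _ _ _ =>
    cases hT
    exact ⟨⟨_, .ax⟩, .inl fun x hx => sem_sig_tag _ _ _ (fun _ => .univ) hx⟩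
  | idt hσ ha hb _ _ _ =>
    cases hT
    exact ⟨⟨_, .ax⟩, .inr fun p q hp hq =>
      derivable_idt_idt (hσ.subst .nil hf) (ha.subst .nil hf) (hb.subst .nil hf) hp hq⟩
  | @lam Γ U T b s h hb _ ih =>
    have tπ := h.subst .nil hf
    refine ⟨⟨_, tπ⟩, ?_⟩
    have tL := (Typed.lam h hb).subst .nil hf
    cases hT with
    | kndPi hU hT =>
      intro a ha
      have hf' : SubOK [] (U :: Γ) (scons a f) := ⟨ha, hf⟩
      have hΔ' := hΔ.obj hU
      -- The computability condition on the new entry is vacuous, because the domain is a type and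
      -- not a kind.
      obtain ⟨⟨_, tT⟩, hM⟩ := ih hΔ' hT hf' ⟨fun Δ' k h h' => (by
        cases hΔ.unique h; cases hU.unique h'), hr⟩
      have tb := hb.subst .nil hf'
      have cT := hT.subst (hf'.cs hΔ')
      have tβ := tL.app ha
      -- `Red` holds for the contractum and is pulled back along this β-conversion.
      have hβ := Conv.beta (Tm.subst f U) (Tm.subst (liftSub f) b) a
      rw [inst_subst_liftSub] at tβ hβ ⊢
      exact hM.of_conv cT tT hβ tβ tb
  | app h ha ih _ =>
    obtain ⟨Δ', hΔ', h'⟩ := h.hasCls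
    cases hΔ.unique hΔ'
    cases h' with
    | con k _ =>
      cases k with
      | kndPi hU k =>
        cases (k.inst_obj _).unique hT
        obtain ⟨⟨_, tπ⟩, hM⟩ := ih hΔ (.kndPi hU k) hf hr
        have ta := ha.subst .nil hf
        obtain ⟨_, _, _, tT⟩ := tπ.pi_inv
        rw [subst_inst]
        exact ⟨⟨_, tT.inst_closed ta⟩, hM _ ta⟩
    | obj k =>
      cases k with
      | piObj _ k => cases (k.inst_obj _).unique hT
      | piKnd hU k => cases (k.inst_con (not_con ha hΔ hU)).unique hT
  | refl h₁ h₂ => cases not_con (.refl h₁ h₂) hΔ hT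
  | J h₁ h₂ h₃ h₄ h₅ => cases not_con (.J h₁ h₂ h₃ h₄ h₅) hΔ hT
  | pair h₁ h₂ h₃ => cases not_con (.pair h₁ h₂ h₃) hΔ hT
  | fst h => cases not_con (.fst h) hΔ hT
  | snd h => cases not_con (.snd h) hΔ hT
  | uip => cases not_con .uip hΔ hT

theorem Typed.tagOrProp {N : Tm} (h : Typed [] N star) : TagOrProp N := by
  have : TagOrProp (Tm.subst Tm.var N) := (h.red .nil .star trivial trivial).2
  rwa [subst_var] at this

/-! ### Tagged terms are not erased terms. -/

/-- All abstractions are annotated by the sort of types. -/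
def NoTag : Tm → Prop
  | srt _ | var _ | Tm.refl | uip => True
  | pi U T | sig U T | app U T | pair U T => NoTag U ∧ NoTag T
  | lam U b => U = star ∧ NoTag b
  | idt σ a b => NoTag σ ∧ NoTag a ∧ NoTag b
  | J c a b q => NoTag c ∧ NoTag a ∧ NoTag b ∧ NoTag q
  | fst p | snd p => NoTag p

namespace NoTag

theorem rename {M : Tm} (h : NoTag M) (r : ℕ → ℕ) : NoTag (Tm.rename r M) := by
  induction M generalizing r <;> simp_all [NoTag, Tm.rename]

theorem subst {M : Tm} (h : NoTag M) {f : ℕ → Tm} (hf : ∀ n, NoTag (f n)) :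
    NoTag (Tm.subst f M) := by
  have lift {f : ℕ → Tm} (hf : ∀ n, NoTag (f n)) (n : ℕ) : NoTag (liftSub f n) := by
    cases n with
    | zero => trivial
    | succ n => exact (hf n).rename _
  induction M generalizing f <;> simp_all [NoTag, Tm.subst]

theorem par {M N : Tm} (h : NoTag M) (hp : Par M N) : NoTag N := by
  induction hp with
  | lam p _ _ ih =>
    obtain ⟨rfl, h⟩ := h
    cases p
    exact ⟨rfl, ih h⟩
  | beta U _ _ ih ih' =>
    exact (ih h.1.2).subst fun n => by
      cases n with
      | zero => exact ih' h.2
      | succ n => trivial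
  | _ => simp_all [NoTag]

theorem pars {M N : Tm} (h : NoTag M) (hp : Pars M N) : NoTag N := by
  induction hp with
  | refl => exact h
  | tail _ p ih => exact ih.par p

theorem tr (M : Tm) : NoTag (Tm.tr M) := by
  induction M <;> simp_all [NoTag, Tm.tr, sel₁, sel₂, shift, NoTag.rename]

/-- Every reduct of a tagged term is still an abstraction annotated by `Kind`, since sorts do not
reduce and there is no η-rule. A common reduct with a tag-free term would have the annotation `star`
instead. -/
theorem not_conv_tag {M N : Tm} (h : NoTag M) : ¬ Conv (tag N) M := by
  intro hc
  obtain ⟨Q, p, q⟩ := hc.join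
  have : ∃ b, Q = lam (srt .kind) b := by
    clear q
    induction p with
    | refl => exact ⟨_, rfl⟩
    | tail _ p ih =>
      obtain ⟨b, rfl⟩ := ih
      cases p with
      | lam p _ => cases p; exact ⟨_, rfl⟩
  obtain ⟨b, rfl⟩ := this
  exact absurd (h.pars q).1 nofun

end NoTag

/-! ### Numerals and the conclusion. -/

/-- Realizers of the numerals of a signature. -/
def num (Z S : Tm) : ℕ → Tm
  | 0 => tr Z
  | k + 1 => app (tr S) (num Z S k)

theorem noTag_num (Z S : Tm) (k : ℕ) : NoTag (num Z S k) := by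
  induction k with
  | zero => exact NoTag.tr Z
  | succ k ih => exact ⟨NoTag.tr S, ih⟩

/-- The predicate of being a numeral. -/
def numPred (Z S : Tm) : List Tm → Set Tm
  | [] => Set.univ
  | n :: _ => {_x | ∃ k, Conv n (num Z S k)}

/-- Each value is either everything or empty, so closure under `tag` is automatic. -/
theorem polyFun_numPred (Z S : Tm) : PolyFun (numPred Z S) where
  congr h := by
    cases h with
    | nil => rfl
    | cons h _ =>
      ext x
      exact exists_congr fun k => ⟨fun h' => h.symm'.trans' h', fun h' => h.trans' h'⟩
  poly l := by
    cases l with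
    | nil => exact .univ
    | cons n l => exact ⟨fun _ h => h, .inl fun _ h => h⟩

theorem subst_tr_shift (M : Tm) (k : ℕ) (ρ : ℕ → Tm) :
    subst ρ (tr (shift k M)) = subst (fun n => ρ (n + k)) (tr M) := by
  rw [shift, tr_rename, subst_rename]

theorem conv_subst_var (M : Tm) : Conv (subst var M) M := by
  rw [subst_var]
  exact .rfl'

/-- The realizer of induction is applied with `P` interpreted by `numPred`. As `P` does not depend
on its own realizers, dummy variables can stand for all the other arguments; only the semantic
content of base and step matters. -/
theorem exists_conv_num {N Z S : Tm} (h : Derivable (indType N Z S)) {x : Tm}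
    (hx : x ∈ sem N var (fun _ _ => Set.univ) []) : ∃ k, Conv x (num Z S k) := by
  obtain ⟨I, hI⟩ := h
  have hη : ∀ _ : ℕ, PolyFun fun _ => Set.univ := fun _ => .univ
  have h₀ := hI.sound (ρ := var) hη trivial
  have h₁ := h₀ (var 0) (fun _ _ _ _ => trivial) _ (polyFun_numPred Z S)
  have h₂ := h₁ (var 0) ⟨0, by
    rw [subst_tr_shift]; exact conv_subst_var (tr Z)⟩ _ .univ
  rw [sem_shift] at h₂
  have h₃ := h₂ (var 0) (by
    intro y _ Y _ p hp W _
    obtain ⟨k, hk⟩ := hp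
    rw [sem_shift]
    refine ⟨k + 1, .app ?_ hk⟩
    rw [subst_tr_shift]
    exact conv_subst_var (tr S)) _ .univ
  rw [sem_shift] at h₃
  exact h₃ x (by rw [sem_shift]; exact hx) _ .univ

/-- Tagging the realizer of zero would give a realizer of `N` that is convertible to no numeral. -/
theorem not_tag_closed {N Z S : Tm} (hN : IsNatSignature N Z S) (h : Derivable (indType N Z S)) :
    ¬ ∀ x ∈ sem N var (fun _ _ => Set.univ) [], tag x ∈ sem N var (fun _ _ => Set.univ) [] := by
  intro ht
  have hZ := hN.zero.sound (ρ := var) (η := fun _ _ => Set.univ) (fun _ => .univ) trivial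
  obtain ⟨k, hk⟩ := exists_conv_num h (ht _ hZ)
  exact (noTag_num Z S k).not_conv_tag hk

theorem IsNatSignature.one {N Z S : Tm} (hN : IsNatSignature N Z S) : Typed [] (app S Z) N := by
  have := Typed.app hN.succ hN.zero
  rwa [inst_shift] at this

theorem not_conv_zero_one {N Z S : Tm} (hN : IsNatSignature N Z S) (h : HasIteration N Z S) :
    ¬ Conv (tr Z) (tr (app S Z)) := by
  intro hc
  obtain ⟨It, -, ⟨P, hP⟩, ⟨Q, hQ⟩⟩ := h
  have hη : ∀ _ : ℕ, PolyFun fun _ => Set.univ := fun _ => .univ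
  have hZ := hN.zero.sound (ρ := var) hη trivial
  -- The constant function with value `var 1`, shifted under its binder. Iterating it from `var 0`,
  -- with the type variable interpreted by `Set.univ`, gives `var 0` at zero and `var 1` at one.
  let c : Tm := lam star (var 2)
  have h₀ := (hP.sound (ρ := var) hη trivial (var 0) trivial _ .univ (var 0) trivial _ .univ c
    (fun _ _ _ _ => trivial) _ .univ).2
  have h₁ := (hQ.sound (ρ := var) hη trivial (var 0) trivial _ .univ (var 0) trivial _ .univ c
    (fun _ _ _ _ => trivial) _ .univ (tr Z) (by
      simp only [shift, sem_rename]
      rw [subst_var] at hZ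
      exact hZ) _ .univ).2
  simp only [tr, subst, subst_tr_shift] at h₀ h₁
  have e (M : Tm) : subst (fun n => var n) M = M := subst_var M
  have h₀' : Conv (app (app (app (app (tr It) (var 0)) (var 0)) c) (tr Z)) (var 0) := by
    simpa only [scons, e] using h₀
  have h₁' : Conv (app (app (app (app (tr It) (var 0)) (var 0)) c) (app (tr S) (tr Z)))
      (app c (app (app (app (app (tr It) (var 0)) (var 0)) c) (tr Z))) := by
    simpa only [scons, e] using h₁
  have h₂ := (Conv.app .rfl' hc).trans' (h₁'.trans' (.beta _ _ _))
  exact not_conv_var zero_ne_one (h₀'.symm'.trans' h₂)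

end LP2

theorem mainTheorem3 :
    (∀ N Z S : LP2.Tm, LP2.IsNatSignature N Z S → LP2.HasIteration N Z S →
      ¬ LP2.Derivable (LP2.indType N Z S)) ∧
    (∀ N Z S : LP2.Tm, LP2.IsNatSignature N Z S →
      ¬ LP2.Derivable (LP2.Tm.idt N Z (LP2.Tm.app S Z)) →
      ¬ LP2.Derivable (LP2.indType N Z S)) := by
  open LP2 in
  refine ⟨fun N Z S hN hIt h => ?_, fun N Z S hN h₀ h => ?_⟩
  · have hη : ∀ _ : ℕ, PolyFun fun _ => Set.univ := fun _ => .univ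
    -- The semantic dichotomy suffices here, because iteration already refutes convertibility of the
    -- realizers of zero and one.
    rcases (sem_polySet N Tm.var hη []).tag_or_refl with ht | hp
    · exact not_tag_closed hN h ht
    · have hZ := hp _ (hN.zero.sound hη trivial)
      have hS := hp _ (hN.one.sound hη trivial)
      rw [Tm.subst_var] at hZ hS
      exact not_conv_zero_one hN hIt (hZ.trans' hS.symm')
  -- Convertible realizers would not yield a derivation of the equation, so the dichotomy on
  -- derivability is used instead.
  · rcases hN.type.tagOrProp with ht | hp
    · exact not_tag_closed hN h ht
    · exact h₀ (hp _ _ hN.zero hN.one)
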